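/- Let $\mathbb{F}_q$ be a finite field of odd characteristic and $v=q-1$. For $n\ge 0$ let $U=U_n$ be the maximal unipotent subgroup of the symplectic group $\mathrm{Sp}_{2n}(\mathbb{F}_q)$ consisting of its lower unitriangular matrices with respect to the ordering $1,2,\dots,n,-n,\dots,-2,-1$ of rows and columns, and let $\mathfrak{u}=\mathfrak{u}_n$ be its Lie algebra, spanned by the matrices $e_{-i,i}$ ($1\le i\le n$), $e_{j,i}-e_{-i,-j}$ and $e_{-j,i}+e_{-i,j}$ ($1\le i<j\le n$), where $e_{a,b}$ are the elementary matrices. The group $U$ acts on $\mathfrak{u}$ by conjugation and on the dual space $\mathfrak{u}^*$ by the coadjoint action $(g.f)(x)=f(g^{-1}xg)$. The dimension of a coadjoint orbit $\Omega\subset\mathfrak{u}^*$ is the number $\dim\Omega$ with $q^{\dim\Omega}=|\Omega|$. Let $S_n$ be the number of coadjoint orbits of $U_n$ of maximal dimension (so $S_0=1$, and $S_1=q$). Then: 1. $S_{n}=vS_{n-1}+vS_{n-2}$ for all $n\ge 2$. 2. $S_n=Ar_1^n+Br_2^n$ for all $n\ge 0$, where $$A=\frac{v+2+\sqrt{v^2+4v}}{2\sqrt{v^2+4v}},\quad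 B=\frac{-v-2+\sqrt{v^2+4v}}{2\sqrt{v^2+4v}},\quad r_1=\frac{v+\sqrt{v^2+4v}}{2},\quad r_2=\frac{v-\sqrt{v^2+4v}}{2}.$$ 3. For every $n$ there is a polynomial $P_n$ with non-negative integer coefficients, not depending on the field $\mathbb{F}_q$, such that $S_n=P_n(v)$. -/

import Mathlib

namespace SymplecticUnipotent

/-- The indices `1, …, n, -n, …, -1` of the rows and columns of `2n × 2n` matrices:
`Sum.inl i` is the index `i` and `Sum.inr i` is the index `-i`. -/
abbrev Idx (n : ℕ) : Type := Fin n ⊕ Fin n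

/-- The position of an index in the mirror order `1 ≺ 2 ≺ … ≺ n ≺ -n ≺ … ≺ -2 ≺ -1`. -/
def pos {n : ℕ} : Idx n → ℕ
  | Sum.inl i => i.val
  | Sum.inr i => 2 * n - 1 - i.val

/-- The root vector `e_{2ε_i} = e_{-i,i}`. -/
def rootLong {n : ℕ} (F : Type*) [Field F] (i : Fin n) : Matrix (Idx n) (Idx n) F :=
  Matrix.single (Sum.inr i) (Sum.inl i) 1

/-- The root vector `e_{ε_i - ε_j} = e_{j,i} - e_{-i,-j}`. -/
def rootMinus {n : ℕ} (F : Type*) [Field F] (i j : Fin n) : Matrix (Idx n) (Idx n) F :=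
  Matrix.single (Sum.inl j) (Sum.inl i) 1 - Matrix.single (Sum.inr i) (Sum.inr j) 1

/-- The root vector `e_{ε_i + ε_j} = e_{-j,i} + e_{-i,j}`. -/
def rootPlus {n : ℕ} (F : Type*) [Field F] (i j : Fin n) : Matrix (Idx n) (Idx n) F :=
  Matrix.single (Sum.inr j) (Sum.inl i) 1 + Matrix.single (Sum.inr i) (Sum.inl j) 1

/-- The root vectors of all positive roots of `C_n`. -/
def rootVectors (n : ℕ) (F : Type*) [Field F] : Set (Matrix (Idx n) (Idx n) F) :=
  {x | (∃ i, x = rootLong F i) ∨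
    ∃ i j, i < j ∧ (x = rootMinus F i j ∨ x = rootPlus F i j)}

/-- The maximal nilpotent subalgebra `𝔲` of the symplectic Lie algebra, spanned by the
root vectors of the positive roots. -/
def nilAlgebra (n : ℕ) (F : Type*) [Field F] : Submodule F (Matrix (Idx n) (Idx n) F) :=
  Submodule.span F (rootVectors n F)

/-- Lower unitriangular matrices with respect to the mirror order of the indices. -/
def IsLowerUnitriangular {n : ℕ} {F : Type*} [Field F] (g : Matrix (Idx n) (Idx n) F) : Prop :=
  (∀ a, g a a = 1) ∧ ∀ a b, pos a < pos b → g a b = 0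

theorem pos_injective {n : ℕ} : Function.Injective (pos (n := n)) := by
  rintro (i | i) (j | j) h <;> simp only [pos] at h <;> congr 1 <;> omega

theorem IsLowerUnitriangular.mul {n : ℕ} {F : Type*} [Field F] {g h : Matrix (Idx n) (Idx n) F}
    (hg : IsLowerUnitriangular g) (hh : IsLowerUnitriangular h) :
    IsLowerUnitriangular (g * h) := by
  refine ⟨fun a => ?_, fun a b hab => ?_⟩
  · rw [Matrix.mul_apply, Finset.sum_eq_single a]
    · rw [hg.1, hh.1, one_mul]
    · intro c _ hc
      rcases lt_trichotomy (pos a) (pos c) with h1 | h1 | h1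
      · rw [hg.2 a c h1, zero_mul]
      · exact absurd (pos_injective h1).symm hc
      · rw [hh.2 c a h1, mul_zero]
    · simp
  · rw [Matrix.mul_apply]
    refine Finset.sum_eq_zero fun c _ => ?_
    rcases lt_or_ge (pos a) (pos c) with h1 | h1
    · rw [hg.2 a c h1, zero_mul]
    · rw [hh.2 c b (by omega), mul_zero]

theorem IsLowerUnitriangular.inv {n : ℕ} {F : Type*} [Field F] {g : Matrix (Idx n) (Idx n) F}
    (hg : IsLowerUnitriangular g) :
    IsLowerUnitriangular (-Matrix.J (Fin n) F * g.transpose * Matrix.J (Fin n) F) := by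
  have key : -Matrix.J (Fin n) F * g.transpose * Matrix.J (Fin n) F =
      Matrix.fromBlocks g.toBlocks₂₂.transpose (-g.toBlocks₁₂.transpose)
        (-g.toBlocks₂₁.transpose) g.toBlocks₁₁.transpose := by
    conv_lhs => rw [← Matrix.fromBlocks_toBlocks g]
    simp [Matrix.J, Matrix.fromBlocks_transpose, Matrix.fromBlocks_multiply,
      Matrix.fromBlocks_neg]
  rw [key]
  constructor
  · rintro (i | i)
    · simpa [Matrix.toBlocks₂₂] using hg.1 (Sum.inr i)
    · simpa [Matrix.toBlocks₁₁] using hg.1 (Sum.inl i)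
  · rintro (i | i) (j | j) hij <;> simp only [pos] at hij
    · simpa [Matrix.toBlocks₂₂] using hg.2 (Sum.inr j) (Sum.inr i) (by simp only [pos]; omega)
    · simpa [Matrix.toBlocks₁₂] using hg.2 (Sum.inl j) (Sum.inr i) (by simp only [pos]; omega)
    · omega
    · simpa [Matrix.toBlocks₁₁] using hg.2 (Sum.inl j) (Sum.inl i) (by simp only [pos]; omega)

/-- The maximal unipotent subgroup `U` of the symplectic group: the lower unitriangular
symplectic matrices. -/
def unipotentSubgroup (n : ℕ) (F : Type*) [Field F] :
    Subgroup (Matrix.symplecticGroup (Fin n) F) where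
  carrier := {g | IsLowerUnitriangular (g : Matrix (Idx n) (Idx n) F)}
  one_mem' := by
    refine ⟨fun a => by simp, fun a b hab => ?_⟩
    have : a ≠ b := by rintro rfl; exact lt_irrefl _ hab
    simp [this]
  mul_mem' := fun hg hh => hg.mul hh
  inv_mem' := fun hg => hg.inv

theorem skew_iff {n : ℕ} {F : Type*} [Field F] {x : Matrix (Idx n) (Idx n) F} :
    x.transpose * Matrix.J (Fin n) F = -(Matrix.J (Fin n) F * x) ↔
      (∀ i j, x (Sum.inr j) (Sum.inl i) = x (Sum.inr i) (Sum.inl j)) ∧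
      (∀ i j, x (Sum.inr i) (Sum.inr j) = -x (Sum.inl j) (Sum.inl i)) ∧
      (∀ i j, x (Sum.inl j) (Sum.inr i) = x (Sum.inl i) (Sum.inr j)) := by
  have key : x.transpose * Matrix.J (Fin n) F = -(Matrix.J (Fin n) F * x) ↔
      Matrix.fromBlocks x.toBlocks₂₁.transpose (-x.toBlocks₁₁.transpose)
        x.toBlocks₂₂.transpose (-x.toBlocks₁₂.transpose) =
      Matrix.fromBlocks x.toBlocks₂₁ x.toBlocks₂₂ (-x.toBlocks₁₁) (-x.toBlocks₁₂) := by
    conv_lhs => rw [← Matrix.fromBlocks_toBlocks x]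
    simp [Matrix.J, Matrix.fromBlocks_transpose, Matrix.fromBlocks_multiply,
      Matrix.fromBlocks_neg]
  rw [key, Matrix.fromBlocks_inj]
  simp only [← Matrix.ext_iff, Matrix.transpose_apply, Matrix.neg_apply, Matrix.toBlocks₁₁,
    Matrix.toBlocks₁₂, Matrix.toBlocks₂₁, Matrix.toBlocks₂₂, Matrix.of_apply, neg_inj]
  constructor
  · rintro ⟨h1, h2, h3, h4⟩
    exact ⟨h1, fun i j => (h2 i j).symm, h4⟩
  · rintro ⟨h1, h2, h3⟩
    exact ⟨h1, fun i j => (h2 i j).symm, fun i j => h2 j i, h3⟩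

/-- `𝔲` consists of the strictly lower triangular matrices of the symplectic Lie algebra. -/
theorem mem_nilAlgebra_iff {n : ℕ} {F : Type*} [Field F] {x : Matrix (Idx n) (Idx n) F} :
    x ∈ nilAlgebra n F ↔ (∀ a b, pos a ≤ pos b → x a b = 0) ∧
      x.transpose * Matrix.J (Fin n) F = -(Matrix.J (Fin n) F * x) := by
  constructor
  · intro hx
    induction hx using Submodule.span_induction with
    | zero => simp
    | add x y _ _ hx hy =>
      refine ⟨fun a b hab => by simp [hx.1 a b hab, hy.1 a b hab], ?_⟩
      rw [Matrix.transpose_add, add_mul, mul_add, hx.2, hy.2, neg_add]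
    | smul c x _ hx =>
      refine ⟨fun a b hab => by simp [hx.1 a b hab], ?_⟩
      rw [Matrix.transpose_smul, Matrix.smul_mul, Matrix.mul_smul, hx.2, smul_neg]
    | mem x hx =>
      rw [skew_iff]
      rcases hx with ⟨i, rfl⟩ | ⟨i, j, hij, rfl | rfl⟩
      · refine ⟨?_, fun k l => ?_, fun k l => ?_, fun k l => ?_⟩
        · rintro (a | a) (b | b) hab <;> simp [rootLong, Matrix.single_apply, pos] at hab ⊢
          omega
        · simp [rootLong, Matrix.single_apply, and_comm]
        · simp [rootLong]
        · simp [rootLong]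
      · refine ⟨?_, fun k l => ?_, fun k l => ?_, fun k l => ?_⟩
        · have hij' : i.val < j.val := hij
          rintro (a | a) (b | b) hab <;> simp [rootMinus, Matrix.single_apply, pos] at hab ⊢
          · rintro rfl rfl; omega
          · rintro rfl rfl; omega
        · simp [rootMinus]
        · simp [rootMinus, Matrix.single_apply, and_comm]
        · simp [rootMinus]
      · refine ⟨?_, fun k l => ?_, fun k l => ?_, fun k l => ?_⟩
        · have hij' : i.val < j.val := hij
          rintro (a | a) (b | b) hab <;> simp [rootPlus, Matrix.single_apply, pos] at hab ⊢
          omega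
        · simp [rootPlus, Matrix.single_apply, and_comm, add_comm]
        · simp [rootPlus]
        · simp [rootPlus]
  · rintro ⟨hlow, hskew⟩
    rw [skew_iff] at hskew
    obtain ⟨h1, h2, h3⟩ := hskew
    have hx : x = (∑ i, x (Sum.inr i) (Sum.inl i) • rootLong F i) +
        ∑ i, ∑ j, if i < j then x (Sum.inl j) (Sum.inl i) • rootMinus F i j +
          x (Sum.inr j) (Sum.inl i) • rootPlus F i j else 0 := by
      have hu : ∀ i j, ¬ j < i → x (Sum.inl i) (Sum.inl j) = 0 := fun i j hij =>
        hlow _ _ (by simpa [pos] using hij)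
      have hr : ∀ i j, x (Sum.inl i) (Sum.inr j) = 0 := fun i j =>
        hlow _ _ (by simp only [pos]; omega)
      ext (a | a) (b | b)
      · have : ∀ i j : Fin n, (if i < j then x (Sum.inl j) (Sum.inl i) • rootMinus F i j +
            x (Sum.inr j) (Sum.inl i) • rootPlus F i j else 0) (Sum.inl a) (Sum.inl b) =
            if i = b then if j = a then x (Sum.inl a) (Sum.inl b) else 0 else 0 := by
          intro i j
          clear hlow h1 h2 h3 hr
          by_cases hij : i < j
          · rw [if_pos hij]
            by_cases hb : i = b <;> by_cases ha : j = a <;>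
              simp [rootMinus, rootPlus, ha, hb]
          · rw [if_neg hij, Matrix.zero_apply]
            split_ifs with hb ha
            · subst hb ha; rw [hu _ _ hij]
            · rfl
            · rfl
        simp [Matrix.sum_apply, this, rootLong]
      · have : ∀ i j : Fin n, (if i < j then x (Sum.inl j) (Sum.inl i) • rootMinus F i j +
            x (Sum.inr j) (Sum.inl i) • rootPlus F i j else 0) (Sum.inl a) (Sum.inr b) = 0 := by
          intro i j
          by_cases hij : i < j <;> simp [hij, rootMinus, rootPlus]
        simp [Matrix.sum_apply, this, rootLong, hr]
      · have : ∀ i j : Fin n, (if i < j then x (Sum.inl j) (Sum.inl i) • rootMinus F i j +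
            x (Sum.inr j) (Sum.inl i) • rootPlus F i j else 0) (Sum.inr a) (Sum.inl b) =
            (if i = b then if j = a then if b < a then x (Sum.inr a) (Sum.inl b) else 0
              else 0 else 0) +
            (if i = a then if j = b then if a < b then x (Sum.inr a) (Sum.inl b) else 0
              else 0 else 0) := by
          intro i j
          by_cases hij : i < j
          · rw [if_pos hij]
            simp only [rootMinus, rootPlus, Matrix.add_apply, Matrix.smul_apply,
              Matrix.sub_apply, Matrix.single_apply, smul_eq_mul, Sum.inr.injEq, Sum.inl.injEq,
              reduceCtorEq, false_and, and_false, if_false, sub_zero, mul_zero, zero_add]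
            by_cases hb : i = b
            · subst hb
              have hji : j ≠ i := hij.ne'
              by_cases ha : j = a
              · subst ha; simp [hij, hij.ne, hij.ne']
              · simp [ha, hji]
            · by_cases hb' : i = a
              · subst hb'
                by_cases ha' : j = b
                · subst ha'; simp [hij, hij.ne, h1 i j]
                · simp [hb, ha']
              · simp [hb, hb']
          · rw [if_neg hij, Matrix.zero_apply]
            have e1 : (if i = b then if j = a then if b < a then x (Sum.inr a) (Sum.inl b) else 0
                else 0 else 0) = 0 := by
              split_ifs with hb ha h
              · subst hb ha; exact absurd h hij
              all_goals rfl
            have e2 : (if i = a then if j = b then if a < b then x (Sum.inr a) (Sum.inl b) else 0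
                else 0 else 0) = 0 := by
              split_ifs with hb ha h
              · subst hb ha; exact absurd h hij
              all_goals rfl
            rw [e1, e2, add_zero]
        simp only [Matrix.add_apply, Matrix.sum_apply, this, Finset.sum_add_distrib,
          rootLong, Matrix.smul_apply,
          Matrix.single_apply, Sum.inr.injEq, Sum.inl.injEq, smul_eq_mul]
        rcases lt_trichotomy a b with h | rfl | h
        · have hn : ∀ i : Fin n, ¬ (i = a ∧ i = b) := by
            rintro i ⟨rfl, rfl⟩; exact lt_irrefl _ h
          simp [h, h.not_gt, hn]
        · simp
        · have hn : ∀ i : Fin n, ¬ (i = a ∧ i = b) := by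
            rintro i ⟨rfl, rfl⟩; exact lt_irrefl _ h
          simp [h, h.not_gt, hn]
      · have : ∀ i j : Fin n, (if i < j then x (Sum.inl j) (Sum.inl i) • rootMinus F i j +
            x (Sum.inr j) (Sum.inl i) • rootPlus F i j else 0) (Sum.inr a) (Sum.inr b) =
            if i = a then if j = b then x (Sum.inr a) (Sum.inr b) else 0 else 0 := by
          intro i j
          rw [h2 a b]
          by_cases hij : i < j
          · rw [if_pos hij]
            by_cases hb : i = a <;> by_cases ha : j = b <;>
              simp [rootMinus, rootPlus, ha, hb]
          · rw [if_neg hij, Matrix.zero_apply]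
            split_ifs with hb ha
            · subst hb ha; rw [hu _ _ hij, neg_zero]
            · rfl
            · rfl
        simp [Matrix.sum_apply, this, rootLong]
    rw [hx]
    refine Submodule.add_mem _ (Submodule.sum_mem _ fun i _ => Submodule.smul_mem _ _
      (Submodule.subset_span (Or.inl ⟨i, rfl⟩))) (Submodule.sum_mem _ fun i _ =>
        Submodule.sum_mem _ fun j _ => ?_)
    split_ifs with hij
    · exact Submodule.add_mem _
        (Submodule.smul_mem _ _ (Submodule.subset_span (Or.inr ⟨i, j, hij, Or.inl rfl⟩)))
        (Submodule.smul_mem _ _ (Submodule.subset_span (Or.inr ⟨i, j, hij, Or.inr rfl⟩)))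
    · exact Submodule.zero_mem _

theorem conj_mem {n : ℕ} {F : Type*} [Field F] (g : unipotentSubgroup n F)
    {x : Matrix (Idx n) (Idx n) F} (hx : x ∈ nilAlgebra n F) :
    ((g : Matrix.symplecticGroup (Fin n) F) : Matrix (Idx n) (Idx n) F) * x *
      ((g⁻¹ : unipotentSubgroup n F) : Matrix.symplecticGroup (Fin n) F) ∈ nilAlgebra n F := by
  rw [mem_nilAlgebra_iff] at hx ⊢
  obtain ⟨hx1, hx2⟩ := hx
  have hg : IsLowerUnitriangular
      ((g : Matrix.symplecticGroup (Fin n) F) : Matrix (Idx n) (Idx n) F) := g.2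
  have hh : IsLowerUnitriangular (((g⁻¹ : unipotentSubgroup n F) :
      Matrix.symplecticGroup (Fin n) F) : Matrix (Idx n) (Idx n) F) := (g⁻¹).2
  have hgh : ((g : Matrix.symplecticGroup (Fin n) F) : Matrix (Idx n) (Idx n) F) *
      ((g⁻¹ : unipotentSubgroup n F) : Matrix.symplecticGroup (Fin n) F) = 1 := by
    rw [← Submonoid.coe_mul, ← Subgroup.coe_mul, mul_inv_cancel]; rfl
  have hgs := SymplecticGroup.mem_iff'.1 (g : Matrix.symplecticGroup (Fin n) F).2
  revert hg hh hgh hgs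
  generalize ((g : Matrix.symplecticGroup (Fin n) F) : Matrix (Idx n) (Idx n) F) = A
  intro hg hh hgh hgs
  revert hh hgh
  generalize (((g⁻¹ : unipotentSubgroup n F) :
    Matrix.symplecticGroup (Fin n) F) : Matrix (Idx n) (Idx n) F) = B
  intro hh hgh
  constructor
  · intro a b hab
    rw [Matrix.mul_apply]
    refine Finset.sum_eq_zero fun c _ => ?_
    rcases lt_or_ge (pos c) (pos b) with h | h
    · rw [hh.2 c b h, mul_zero]
    · rw [Matrix.mul_apply, Finset.sum_eq_zero, zero_mul]
      intro d _
      rcases lt_or_ge (pos a) (pos d) with h' | h'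
      · rw [hg.2 a d h', zero_mul]
      · rw [hx1 d c (by omega), mul_zero]
  · have e1 : A.transpose * Matrix.J (Fin n) F = Matrix.J (Fin n) F * B := by
      calc A.transpose * Matrix.J (Fin n) F
          = A.transpose * Matrix.J (Fin n) F * (A * B) := by rw [hgh, mul_one]
        _ = (A.transpose * Matrix.J (Fin n) F * A) * B := by simp only [mul_assoc]
        _ = _ := by rw [hgs]
    have hgt : B.transpose * A.transpose = 1 := by
      rw [← Matrix.transpose_mul, hgh, Matrix.transpose_one]
    have e2 : Matrix.J (Fin n) F * A = B.transpose * Matrix.J (Fin n) F := by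
      calc Matrix.J (Fin n) F * A
          = B.transpose * A.transpose * Matrix.J (Fin n) F * A := by rw [hgt, one_mul]
        _ = B.transpose * (A.transpose * Matrix.J (Fin n) F * A) := by simp only [mul_assoc]
        _ = _ := by rw [hgs]
    calc (A * x * B).transpose * Matrix.J (Fin n) F
        = B.transpose * (x.transpose * (A.transpose * Matrix.J (Fin n) F)) := by
          simp only [Matrix.transpose_mul, mul_assoc]
      _ = B.transpose * (x.transpose * Matrix.J (Fin n) F) * B := by
          rw [e1]; simp only [mul_assoc]
      _ = -((B.transpose * Matrix.J (Fin n) F) * x * B) := by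
          rw [hx2]; simp only [mul_neg, neg_mul, mul_assoc]
      _ = -(Matrix.J (Fin n) F * (A * x * B)) := by
          rw [← e2]; simp only [mul_assoc]

/-- The adjoint representation of `U` on `𝔲`, `g ↦ (x ↦ g x g⁻¹)`. -/
def adjointRep (n : ℕ) (F : Type*) [Field F] :
    Representation F (unipotentSubgroup n F) (nilAlgebra n F) where
  toFun g :=
    { toFun := fun x => ⟨((g : Matrix.symplecticGroup (Fin n) F) : Matrix (Idx n) (Idx n) F) *
        (x : Matrix (Idx n) (Idx n) F) *
        ((g⁻¹ : unipotentSubgroup n F) : Matrix.symplecticGroup (Fin n) F), conj_mem g x.2⟩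
      map_add' := fun x y => by ext1; simp [mul_add, add_mul]
      map_smul' := fun c x => by ext1; simp }
  map_one' := by ext1 x; ext1; simp
  map_mul' g h := by ext1 x; ext1; simp [mul_assoc]

/-- The coadjoint representation of `U` on the dual space `𝔲*`, `(g.f)(x) = f(g⁻¹ x g)`. -/
abbrev coadjointRep (n : ℕ) (F : Type*) [Field F] :
    Representation F (unipotentSubgroup n F) (Module.Dual F (nilAlgebra n F)) :=
  (adjointRep n F).dual

/-- The coadjoint orbit of a linear form. -/
def coadjointOrbit {n : ℕ} {F : Type*} [Field F] (f : Module.Dual F (nilAlgebra n F)) :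
    Set (Module.Dual F (nilAlgebra n F)) :=
  Set.range fun g : unipotentSubgroup n F => coadjointRep n F g f

/-- The set `𝔲*/U` of coadjoint orbits. -/
def coadjointOrbits (n : ℕ) (F : Type*) [Field F] :
    Set (Set (Module.Dual F (nilAlgebra n F))) :=
  Set.range coadjointOrbit

/-- The dimension of a coadjoint orbit over `F = 𝔽_q`: the number `d` with `q ^ d = |Ω|`. -/
noncomputable def orbitDim {n : ℕ} {F : Type*} [Field F]
    (Ω : Set (Module.Dual F (nilAlgebra n F))) : ℝ :=
  Real.logb (Nat.card F) (Nat.card Ω)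

/-- The set of coadjoint orbits of maximal dimension. -/
def maxDimOrbits (n : ℕ) (F : Type*) [Field F] :
    Set (Set (Module.Dual F (nilAlgebra n F))) :=
  {Ω | Ω ∈ coadjointOrbits n F ∧ ∀ Ω' ∈ coadjointOrbits n F, orbitDim Ω' ≤ orbitDim Ω}

/-- The number `S_n` of coadjoint orbits of maximal dimension. -/
noncomputable def numMaxDimOrbits (n : ℕ) (F : Type*) [Field F] : ℕ :=
  (maxDimOrbits n F).ncard

end SymplecticUnipotent

/-! A form on 𝔲 is a unique pair (Y, X) with Y symmetric and X strictly lower triangular, paired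
with the lower left and upper left blocks of 𝔲. An element of U with upper left block a sends Y to a
Y aᵀ, so the orbit of (Y, X) lies in the set of pairs (a Y aᵀ, X') with a lower unitriangular and X'
arbitrary. This bounds its size by L·T, where L and T count lower unitriangular and strictly lower
triangular matrices.

The bound is attained exactly when Y is rigid, that is, when a Y aᵀ = Y forces a = 1. Rigidity is
clearly necessary. Conversely, the Cayley transform turns rigidity into infinitesimal rigidity
(`IsRigid.eq_zero_of_skew`), and by duality the elements of U with a = 1 then move X to any X'
(`IsRigid.exists_symm_lowerPart`, `coadjointOrbit_eq_range`). The identity matrix is rigid, so L·T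
is the maximal orbit size, and S_n·L is the number R_n of rigid symmetric matrices
(`numMaxDimOrbits_mul`).

Rigid matrices are counted by Schur complements (`card_rigid_leading`). One splits off a leading 1×1
block if Y₀₀ ≠ 0, or a leading 2×2 block if Y₀₀ = 0 ≠ Y₀₁; if both entries vanish, Y is not rigid
(`not_isRigid_of_leading_zero`). The resulting recursion for R_n, divided by L, is the recursion for
S_n, from which Binet's formula and the polynomials follow by induction. -/

open Matrix

namespace SymplecticUnipotent

/-! ### Rigidity under unitriangular congruence. -/

section Rigid

variable {n m p : ℕ} {F : Type*} [Field F]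

/-- Lower unitriangular square matrices. -/
def LowerUni (a : Matrix (Fin n) (Fin n) F) : Prop :=
  (∀ i, a i i = 1) ∧ ∀ i j, i < j → a i j = 0

/-- Strictly lower triangular square matrices. -/
def StrictLower (a : Matrix (Fin n) (Fin n) F) : Prop :=
  ∀ i j, i ≤ j → a i j = 0

/-- A matrix with trivial stabilizer under the congruence action of the lower unitriangular
group. -/
def IsRigid (Y : Matrix (Fin n) (Fin n) F) : Prop :=
  ∀ a, LowerUni a → a * Y * aᵀ = Y → a = 1

theorem lowerUni_one : LowerUni (1 : Matrix (Fin n) (Fin n) F) :=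
  ⟨fun i => by simp, fun i j h => by simp [h.ne]⟩

theorem LowerUni.mul {a b : Matrix (Fin n) (Fin n) F} (ha : LowerUni a) (hb : LowerUni b) :
    LowerUni (a * b) := by
  refine ⟨fun i => ?_, fun i j hij => ?_⟩
  · rw [mul_apply, Finset.sum_eq_single i]
    · rw [ha.1, hb.1, one_mul]
    · intro c _ hc
      rcases lt_or_gt_of_ne hc with h | h
      · rw [hb.2 c i h, mul_zero]
      · rw [ha.2 i c h, zero_mul]
    · simp
  · rw [mul_apply]
    refine Finset.sum_eq_zero fun c _ => ?_
    rcases lt_or_ge i c with h | h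
    · rw [ha.2 i c h, zero_mul]
    · rw [hb.2 c j (h.trans_lt hij), mul_zero]

theorem LowerUni.det {a : Matrix (Fin n) (Fin n) F} (ha : LowerUni a) : a.det = 1 := by
  rw [det_of_isLowerTriangular a (fun i j h => ha.2 i j h)]
  simp [ha.1]

/-- Over a finite field an invertible matrix has finite order, so its inverse is one of its powers
and stays lower unitriangular. -/
theorem LowerUni.exists_inv [Finite F] {a : Matrix (Fin n) (Fin n) F} (ha : LowerUni a) :
    ∃ b, LowerUni b ∧ a * b = 1 ∧ b * a = 1 := by
  have hu : IsUnit a := by rw [isUnit_iff_isUnit_det, ha.det]; exact isUnit_one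
  obtain ⟨u, rfl⟩ := hu
  obtain ⟨k, hk, hk1⟩ := (isOfFinOrder_of_finite u).exists_pow_eq_one
  have hpow : ∀ j : ℕ, LowerUni ((u : Matrix (Fin n) (Fin n) F) ^ j) := by
    intro j
    induction j with
    | zero => simpa using lowerUni_one
    | succ j ih => rw [pow_succ]; exact ih.mul ha
  have h1 : (u : Matrix (Fin n) (Fin n) F) ^ k = 1 := by
    rw [← Units.val_pow_eq_pow_val, hk1, Units.val_one]
  obtain ⟨l, rfl⟩ : ∃ l, k = l + 1 := ⟨k - 1, by omega⟩
  exact ⟨_, hpow l, by rw [← pow_succ', h1], by rw [← pow_succ, h1]⟩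

theorem StrictLower.lowerUni_one_add {a : Matrix (Fin n) (Fin n) F} (ha : StrictLower a) :
    LowerUni (1 + a) :=
  ⟨fun i => by simp [ha i i le_rfl], fun i j h => by simp [h.ne, ha i j h.le]⟩

theorem StrictLower.neg {a : Matrix (Fin n) (Fin n) F} (ha : StrictLower a) :
    StrictLower (-a) := fun i j h => by simp [ha i j h]

/-- The Cayley transform shows that rigidity implies infinitesimal rigidity. -/
theorem IsRigid.eq_zero_of_skew [Finite F] (h2 : (2 : F) ≠ 0) {Y A : Matrix (Fin n) (Fin n) F}
    (hY : IsRigid Y) (hA : StrictLower A) (h : A * Y + Y * Aᵀ = 0) : A = 0 := by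
  -- Here `b` is (1 - A)⁻¹, and `b * (1 + A)` is the Cayley transform of A. Since A Y = -Y Aᵀ,
  -- moving 1 ± A across Y gives 1 ∓ Aᵀ, so the transform stabilizes Y.
  obtain ⟨b, hb, hb1, hb2⟩ := hA.neg.lowerUni_one_add.exists_inv
  have e : Y * Aᵀ = -(A * Y) := by rw [eq_neg_iff_add_eq_zero, add_comm, h]
  have hbt : (1 + -A)ᵀ * bᵀ = 1 := by rw [← transpose_mul, hb2, transpose_one]
  have k : b * (1 + A) = (1 + A) * b := by
    have c : (1 + A) * (1 + -A) = (1 + -A) * (1 + A) := by noncomm_ring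
    calc b * (1 + A) = b * ((1 + A) * (1 + -A)) * b := by
          rw [mul_assoc, mul_assoc, hb1, mul_one]
      _ = (b * (1 + -A)) * (1 + A) * b := by rw [c]; simp only [mul_assoc]
      _ = _ := by rw [hb2, one_mul]
  have e1 : (1 + A) * Y = Y * (1 + -A)ᵀ := by
    simp only [transpose_add, transpose_one, transpose_neg, mul_add, add_mul, mul_neg, e, one_mul,
      mul_one, neg_neg]
  have e2 : (1 + -A) * Y = Y * (1 + A)ᵀ := by
    simp only [transpose_add, transpose_one, mul_add, add_mul, neg_mul, e, one_mul, mul_one]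
  have key := hY (b * (1 + A)) (hb.mul hA.lowerUni_one_add) (by
    calc b * (1 + A) * Y * (b * (1 + A))ᵀ
        = b * ((1 + A) * Y) * ((1 + A)ᵀ * bᵀ) := by simp only [transpose_mul, mul_assoc]
      _ = b * (Y * ((1 + -A)ᵀ * (1 + A)ᵀ)) * bᵀ := by rw [e1]; simp only [mul_assoc]
      _ = b * (Y * ((1 + A)ᵀ * (1 + -A)ᵀ)) * bᵀ := by
          rw [← transpose_mul, ← transpose_mul]
          congr 4
          noncomm_ring
      _ = b * ((Y * (1 + A)ᵀ) * ((1 + -A)ᵀ * bᵀ)) := by simp only [mul_assoc]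
      _ = (b * (1 + -A)) * Y := by rw [hbt, ← e2, mul_one]; simp only [mul_assoc]
      _ = Y := by rw [hb2, one_mul])
  -- By rigidity the Cayley transform is 1, hence 2A = 0.
  have h3 : 1 + A = 1 + -A := by
    calc 1 + A = (1 + -A) * (b * (1 + A)) := by rw [← mul_assoc, hb1, one_mul]
      _ = _ := by rw [key, mul_one]
  have h4 : A = -A := add_left_cancel h3
  ext i j
  have h5 : A i j = -A i j := congrFun (congrFun h4 i) j
  have h6 : (2 : F) * A i j = 0 := by linear_combination h5
  simpa [h2] using h6

/-- Stabilizers of congruent matrices are conjugate. -/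
theorem IsRigid.congr [Finite F] {Y h : Matrix (Fin n) (Fin n) F} (hY : IsRigid Y)
    (hh : LowerUni h) : IsRigid (h * Y * hᵀ) := by
  obtain ⟨b, hb, hb1, hb2⟩ := hh.exists_inv
  intro a ha e
  have hbt : hᵀ * bᵀ = 1 := by rw [← transpose_mul, hb2, transpose_one]
  have key := hY (b * a * h) ((hb.mul ha).mul hh) (by
    calc b * a * h * Y * (b * a * h)ᵀ = b * (a * (h * Y * hᵀ) * aᵀ) * bᵀ := by
          simp only [transpose_mul, mul_assoc]
      _ = (b * h) * Y * (hᵀ * bᵀ) := by rw [e]; simp only [mul_assoc]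
      _ = Y := by rw [hb2, hbt, one_mul, mul_one])
  calc a = (h * b) * a * (h * b) := by rw [hb1, one_mul, mul_one]
    _ = h * (b * a * h) * b := by simp only [mul_assoc]
    _ = 1 := by rw [key, mul_one, hb1]

theorem isRigid_congr_iff [Finite F] {Y h : Matrix (Fin n) (Fin n) F} (hh : LowerUni h) :
    IsRigid (h * Y * hᵀ) ↔ IsRigid Y := by
  refine ⟨fun H => ?_, fun H => H.congr hh⟩
  obtain ⟨b, hb, hb1, hb2⟩ := hh.exists_inv
  have hbt : hᵀ * bᵀ = 1 := by rw [← transpose_mul, hb2, transpose_one]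
  have := H.congr hb
  rwa [show b * (h * Y * hᵀ) * bᵀ = (b * h) * Y * (hᵀ * bᵀ) by simp only [mul_assoc], hb2, hbt,
    one_mul, mul_one] at this

/-- If a aᵀ = 1, then aᵀ is the inverse of a, hence both lower and upper unitriangular. This
supplies a rigid symmetric matrix of every size, so the bound on orbit sizes is sharp. -/
theorem isRigid_one [Finite F] : IsRigid (1 : Matrix (Fin n) (Fin n) F) := by
  intro a ha h
  rw [mul_one] at h
  obtain ⟨b, hb, -, hb2⟩ := ha.exists_inv
  have e : aᵀ = b := by
    calc aᵀ = b * (a * aᵀ) := by rw [← mul_assoc, hb2, one_mul]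
      _ = b := by rw [h, mul_one]
  ext i j
  rcases lt_trichotomy i j with hij | rfl | hij
  · rw [ha.2 i j hij, one_apply_ne hij.ne]
  · rw [ha.1, one_apply_eq]
  · rw [one_apply_ne hij.ne', ← transpose_apply a, e, hb.2 j i hij]

/-! ### Block decompositions -/

/-- Matrices indexed by `Fin m ⊕ Fin p` as matrices indexed by `Fin (m + p)`. -/
def blk : Matrix (Fin m ⊕ Fin p) (Fin m ⊕ Fin p) F ≃ₐ[F]
    Matrix (Fin (m + p)) (Fin (m + p)) F :=
  reindexAlgEquiv F F finSumFinEquiv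

@[simp] theorem blk_castAdd_castAdd (M : Matrix (Fin m ⊕ Fin p) (Fin m ⊕ Fin p) F) (i j : Fin m) :
    blk M (Fin.castAdd p i) (Fin.castAdd p j) = M (Sum.inl i) (Sum.inl j) := by
  simp [blk]

@[simp] theorem blk_castAdd_natAdd (M : Matrix (Fin m ⊕ Fin p) (Fin m ⊕ Fin p) F) (i : Fin m)
    (j : Fin p) : blk M (Fin.castAdd p i) (Fin.natAdd m j) = M (Sum.inl i) (Sum.inr j) := by
  simp [blk]

@[simp] theorem blk_natAdd_castAdd (M : Matrix (Fin m ⊕ Fin p) (Fin m ⊕ Fin p) F) (i : Fin p)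
    (j : Fin m) : blk M (Fin.natAdd m i) (Fin.castAdd p j) = M (Sum.inr i) (Sum.inl j) := by
  simp [blk]

@[simp] theorem blk_natAdd_natAdd (M : Matrix (Fin m ⊕ Fin p) (Fin m ⊕ Fin p) F) (i j : Fin p) :
    blk M (Fin.natAdd m i) (Fin.natAdd m j) = M (Sum.inr i) (Sum.inr j) := by
  simp [blk]

theorem blk_transpose (M : Matrix (Fin m ⊕ Fin p) (Fin m ⊕ Fin p) F) : (blk M)ᵀ = blk Mᵀ := rfl

theorem exists_blk (Y : Matrix (Fin (m + p)) (Fin (m + p)) F) :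
    ∃ A B C D, Y = blk (fromBlocks A B C D) :=
  ⟨_, _, _, _, by rw [fromBlocks_toBlocks (blk.symm Y), AlgEquiv.apply_symm_apply]⟩

theorem blk_fromBlocks_inj {A A' : Matrix (Fin m) (Fin m) F} {B B' : Matrix (Fin m) (Fin p) F}
    {C C' : Matrix (Fin p) (Fin m) F} {D D' : Matrix (Fin p) (Fin p) F} :
    blk (fromBlocks A B C D) = blk (fromBlocks A' B' C' D') ↔
      A = A' ∧ B = B' ∧ C = C' ∧ D = D' := by
  rw [blk.injective.eq_iff, fromBlocks_inj]

theorem lowerUni_blk {A : Matrix (Fin m) (Fin m) F} {B : Matrix (Fin m) (Fin p) F}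
    {C : Matrix (Fin p) (Fin m) F} {D : Matrix (Fin p) (Fin p) F} :
    LowerUni (blk (fromBlocks A B C D)) ↔ LowerUni A ∧ B = 0 ∧ LowerUni D := by
  constructor
  · rintro ⟨h1, h2⟩
    refine ⟨⟨fun i => ?_, fun i j h => ?_⟩, ?_, ⟨fun i => ?_, fun i j h => ?_⟩⟩
    · simpa using h1 (Fin.castAdd p i)
    · simpa using h2 (Fin.castAdd p i) (Fin.castAdd p j) h
    · ext i j
      simpa using h2 (Fin.castAdd p i) (Fin.natAdd m j) (by simp [Fin.lt_def]; omega)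
    · simpa using h1 (Fin.natAdd m i)
    · simpa using h2 (Fin.natAdd m i) (Fin.natAdd m j) (by simpa using h)
  · rintro ⟨hA, rfl, hD⟩
    refine ⟨fun i => ?_, fun i j h => ?_⟩
    · induction i using Fin.addCases with
      | left i => simp [hA.1]
      | right i => simp [hD.1]
    · induction i using Fin.addCases with
      | left i =>
        induction j using Fin.addCases with
        | left j => simpa using hA.2 i j h
        | right j => simp
      | right i =>
        induction j using Fin.addCases with
        | left j => simp [Fin.lt_def] at h; omega
        | right j => simpa using hD.2 i j (by simpa using h)

theorem blk_fromBlocks_one : blk (fromBlocks 1 0 0 1) =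
    (1 : Matrix (Fin (m + p)) (Fin (m + p)) F) := by
  rw [fromBlocks_one, map_one]

/-- For a stabilizing element with blocks A, C, D, rigidity of H gives A = 1, the off-diagonal
equation C H = 0 gives C = 0 because H is invertible, and D is left stabilizing Y. -/
theorem isRigid_blk_diag {H : Matrix (Fin m) (Fin m) F} {Y : Matrix (Fin p) (Fin p) F}
    (hH : IsUnit H.det) (hr : IsRigid H) :
    IsRigid (blk (fromBlocks H 0 0 Y)) ↔ IsRigid Y := by
  constructor
  · intro h a ha e
    have := h (blk (fromBlocks 1 0 0 a)) (lowerUni_blk.2 ⟨lowerUni_one, rfl, ha⟩) (by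
      rw [blk_transpose, ← map_mul, ← map_mul, fromBlocks_transpose, fromBlocks_multiply,
        fromBlocks_multiply]
      simp [e])
    rw [← blk_fromBlocks_one, blk_fromBlocks_inj] at this
    exact this.2.2.2
  · intro h a ha e
    obtain ⟨A, B, C, D, rfl⟩ := exists_blk a
    obtain ⟨hA, rfl, hD⟩ := lowerUni_blk.1 ha
    rw [blk_transpose, ← map_mul, ← map_mul, fromBlocks_transpose, fromBlocks_multiply,
        fromBlocks_multiply, blk_fromBlocks_inj] at e
    simp only [Matrix.mul_zero, Matrix.zero_mul, add_zero, zero_add, transpose_zero] at e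
    obtain ⟨e1, e2, e3, e4⟩ := e
    obtain rfl := hr A hA e1
    have hC : C = 0 := by
      rw [transpose_one, Matrix.mul_one] at e3
      calc C = C * (H * H⁻¹) := by rw [mul_nonsing_inv H hH, Matrix.mul_one]
        _ = C * H * H⁻¹ := by rw [Matrix.mul_assoc]
        _ = 0 := by rw [e3, Matrix.zero_mul]
    subst hC
    rw [Matrix.zero_mul, Matrix.zero_mul, zero_add] at e4
    rw [h D hD e4, blk_fromBlocks_one]

theorem lowerUni_shear (w : Matrix (Fin p) (Fin m) F) : LowerUni (blk (fromBlocks 1 0 w 1)) :=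
  lowerUni_blk.2 ⟨lowerUni_one, rfl, lowerUni_one⟩

/-- This is the block LDLᵀ factorization: Y is the Schur complement of H in the right-hand side. -/
theorem shear_congr (w : Matrix (Fin p) (Fin m) F) (H : Matrix (Fin m) (Fin m) F)
    (Y : Matrix (Fin p) (Fin p) F) :
    blk (fromBlocks 1 0 w 1) * blk (fromBlocks H 0 0 Y) * (blk (fromBlocks 1 0 w 1))ᵀ =
      blk (fromBlocks H (H * wᵀ) (w * H) (w * H * wᵀ + Y)) := by
  rw [blk_transpose, ← map_mul, ← map_mul, fromBlocks_transpose, fromBlocks_multiply,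
        fromBlocks_multiply]
  simp

/-! ### Counting with Schur complements. -/

variable (F) in
/-- The number of rigid symmetric matrices. -/
noncomputable def numRigid (n : ℕ) : ℕ :=
  Nat.card {Y : Matrix (Fin n) (Fin n) F // Y.IsSymm ∧ IsRigid Y}

variable (F) in
/-- The order of the lower unitriangular group. -/
noncomputable def numLowerUni (n : ℕ) : ℕ :=
  Nat.card {a : Matrix (Fin n) (Fin n) F // LowerUni a}

theorem numLowerUni_pos [Finite F] : 0 < numLowerUni F n :=
  have : Nonempty {a : Matrix (Fin n) (Fin n) F // LowerUni a} := ⟨⟨1, lowerUni_one⟩⟩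
  Nat.card_pos

theorem numLowerUni_add [Finite F] : numLowerUni F (m + p) =
    numLowerUni F m * Nat.card F ^ (p * m) * numLowerUni F p := by
  have e : Nat.card (Matrix (Fin p) (Fin m) F) = Nat.card F ^ (p * m) := by
    rw [Matrix, Nat.card_fun, Nat.card_fun]; simp [pow_mul, mul_comm]
  rw [numLowerUni, numLowerUni, numLowerUni, ← e, ← Nat.card_prod, ← Nat.card_prod]
  symm
  refine Nat.card_congr (Equiv.ofBijective
    (fun t => ⟨blk (fromBlocks t.1.1.1 0 t.1.2 t.2.1), lowerUni_blk.2 ⟨t.1.1.2, rfl, t.2.2⟩⟩)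
    ⟨?_, ?_⟩)
  · rintro ⟨⟨⟨a, ha⟩, b⟩, ⟨c, hc⟩⟩ ⟨⟨⟨a', ha'⟩, b'⟩, ⟨c', hc'⟩⟩ h
    rw [Subtype.mk.injEq, blk_fromBlocks_inj] at h
    obtain ⟨rfl, -, rfl, rfl⟩ := h
    rfl
  · rintro ⟨a, ha⟩
    obtain ⟨A, B, C, D, rfl⟩ := exists_blk a
    obtain ⟨hA, rfl, hD⟩ := lowerUni_blk.1 ha
    exact ⟨⟨⟨⟨A, hA⟩, C⟩, ⟨D, hD⟩⟩, rfl⟩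

/-- Schur complements count rigid symmetric matrices with given kind of leading block. -/
theorem card_rigid_leading [Finite F] (S : Set (Matrix (Fin m) (Fin m) F))
    (hS : ∀ H ∈ S, H.IsSymm ∧ IsUnit H.det ∧ IsRigid H) {N : ℕ} (hN : m + p = N) (hmN : m ≤ N) :
    Nat.card {Y : Matrix (Fin N) (Fin N) F // (Y.IsSymm ∧ IsRigid Y) ∧
      Y.submatrix (Fin.castLE hmN) (Fin.castLE hmN) ∈ S} =
    Nat.card S * Nat.card F ^ (p * m) * numRigid F p := by
  -- The size is a variable `N` because n + 2 is not definitionally 1 + (n + 1) or 2 + n.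
  subst hN
  have e : Nat.card (Matrix (Fin p) (Fin m) F) = Nat.card F ^ (p * m) := by
    rw [Matrix, Nat.card_fun, Nat.card_fun]; simp [pow_mul, mul_comm]
  have hlead : ∀ A B C (D : Matrix (Fin p) (Fin p) F), (blk (fromBlocks A B C D)).submatrix
      (Fin.castLE hmN) (Fin.castLE hmN) = A := fun A B C D => by
    ext i j
    exact blk_castAdd_castAdd _ i j
  rw [numRigid, ← e, ← Nat.card_prod, ← Nat.card_prod]
  symm
  refine Nat.card_congr (Equiv.ofBijective
    (fun t => ⟨blk (fromBlocks t.1.1.1 (t.1.1.1 * t.1.2ᵀ) (t.1.2 * t.1.1.1)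
      (t.1.2 * t.1.1.1 * t.1.2ᵀ + t.2.1)), ⟨?_, ?_⟩, ?_⟩) ⟨?_, ?_⟩)
  · obtain ⟨h1, h2, h3⟩ := hS _ t.1.1.2
    rw [IsSymm, blk_transpose, fromBlocks_transpose, blk_fromBlocks_inj]
    simp [transpose_mul, h1.eq, t.2.2.1.eq, Matrix.mul_assoc]
  · obtain ⟨h1, h2, h3⟩ := hS _ t.1.1.2
    rw [← shear_congr, isRigid_congr_iff (lowerUni_shear _), isRigid_blk_diag h2 h3]
    exact t.2.2.2
  · rw [hlead]
    exact t.1.1.2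
  · rintro ⟨⟨⟨a, ha⟩, b⟩, ⟨c, hc⟩⟩ ⟨⟨⟨a', ha'⟩, b'⟩, ⟨c', hc'⟩⟩ h
    rw [Subtype.mk.injEq, blk_fromBlocks_inj] at h
    obtain ⟨rfl, -, h1, h2⟩ := h
    have hb : b = b' := by
      have hu := (hS _ ha).2.1
      calc b = b * a * a⁻¹ := by rw [Matrix.mul_assoc, mul_nonsing_inv a hu, Matrix.mul_one]
        _ = b' := by
          simp only at h1
          rw [h1, Matrix.mul_assoc, mul_nonsing_inv a hu, Matrix.mul_one]
    subst hb
    obtain rfl := add_left_cancel h2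
    rfl
  · rintro ⟨Y, ⟨hY1, hY2⟩, hY3⟩
    obtain ⟨A, B, C, D, rfl⟩ := exists_blk Y
    have hA := hY3
    rw [hlead] at hA
    obtain ⟨h1, h2, h3⟩ := hS _ hA
    have hY := hY1
    rw [IsSymm, blk_transpose, fromBlocks_transpose, blk_fromBlocks_inj] at hY
    obtain ⟨-, -, rfl, hD⟩ := hY
    -- Surjectivity: the shear is Bᵀ A⁻¹ and the remaining block is the Schur complement D - Bᵀ A⁻¹
    -- B.
    have e1 : (Bᵀ * A⁻¹) * A = Bᵀ := by
      rw [Matrix.mul_assoc, nonsing_inv_mul A h2, Matrix.mul_one]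
    have e2 : A * (Bᵀ * A⁻¹)ᵀ = B := by
      rw [transpose_mul, transpose_nonsing_inv, h1.eq, transpose_transpose, ← Matrix.mul_assoc,
        mul_nonsing_inv A h2, Matrix.one_mul]
    have e3 : blk (fromBlocks A B Bᵀ D) = blk (fromBlocks A (A * (Bᵀ * A⁻¹)ᵀ) ((Bᵀ * A⁻¹) * A)
        ((Bᵀ * A⁻¹) * A * (Bᵀ * A⁻¹)ᵀ + (D - Bᵀ * A⁻¹ * B))) := by
      rw [Matrix.mul_assoc (Bᵀ * A⁻¹), e2, e1, add_sub_cancel]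
    refine ⟨⟨⟨⟨A, hA⟩, Bᵀ * A⁻¹⟩, ⟨D - Bᵀ * A⁻¹ * B, ?_, ?_⟩⟩, Subtype.ext e3.symm⟩
    · rw [IsSymm, transpose_sub, hD, transpose_mul, transpose_mul, transpose_nonsing_inv, h1.eq,
        transpose_transpose, Matrix.mul_assoc]
    · rwa [e3, ← shear_congr, isRigid_congr_iff (lowerUni_shear _), isRigid_blk_diag h2 h3] at hY2

/-- Let y₀, y₁ be the first two columns of Y and A = y₀ e₁ᵀ - y₁ e₀ᵀ. Then A Y = y₀ y₁ᵀ - y₁ y₀ᵀ is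
skew-symmetric, so A Y + Y Aᵀ = 0, and the vanishing entries of Y make A strictly lower triangular.
Rigidity would give A = 0, hence y₀ = 0; but then the elementary matrix at (1, 0) is a nonzero
infinitesimal stabilizer. -/
theorem not_isRigid_of_leading_zero [Finite F] (h2 : (2 : F) ≠ 0)
    {Y : Matrix (Fin (n + 2)) (Fin (n + 2)) F} (hs : Y.IsSymm) (h00 : Y 0 0 = 0)
    (h01 : Y 0 1 = 0) : ¬ IsRigid Y := by
  intro hr
  have h10 : Y 1 0 = 0 := by rw [← hs.apply, h01]
  have hlow : StrictLower (vecMulVec (Y.col 0) (Pi.single 1 1) -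
      vecMulVec (Y.col 1) (Pi.single 0 1)) := by
    intro i j hij
    rw [Matrix.sub_apply, vecMulVec_apply, vecMulVec_apply]
    by_cases hj0 : j = 0
    · subst hj0
      obtain rfl : i = 0 := by simpa using hij
      simp [h01]
    · by_cases hj1 : j = 1
      · subst hj1
        have : i = 0 ∨ i = 1 := by
          rw [Fin.le_def] at hij
          simp only [Fin.ext_iff, Fin.val_zero, Fin.val_one] at hij ⊢
          omega
        rcases this with rfl | rfl <;> simp [h00, h10]
      · simp [hj0, hj1]
  have key := hr.eq_zero_of_skew h2 hlow (by
    ext i j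
    simp [sub_mul, mul_sub, vecMulVec_mul, mul_vecMulVec, transpose_vecMulVec, vecMulVec_apply,
      hs.apply])
  have hz : ∀ i, Y i 0 = 0 := fun i => by
    simpa [vecMulVec_apply] using congrFun (congrFun key i) 1
  have hA : StrictLower (single 1 0 1 : Matrix (Fin (n + 2)) (Fin (n + 2)) F) := by
    intro i j hij
    rw [single_apply, if_neg]
    rintro ⟨rfl, rfl⟩
    simp at hij
  have key' := hr.eq_zero_of_skew h2 hA (by
    ext i j
    have hz' : ∀ i, Y 0 i = 0 := fun i => by rw [← hs.apply, hz]
    simp [mul_apply, single_apply, hz, hz', ite_and])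
  simpa using congrFun (congrFun key' 1) 0

end Rigid

end SymplecticUnipotent

namespace SymplecticUnipotent

/-! ### The recursion for the number of rigid symmetric matrices. -/

section Count

variable {n : ℕ} {F : Type*} [Field F]

theorem numLowerUni_zero : numLowerUni F 0 = 1 := by
  rw [numLowerUni, Nat.card_eq_one_iff_unique]
  exact ⟨⟨fun a b => Subtype.ext (Subsingleton.elim _ _)⟩, ⟨⟨1, lowerUni_one⟩⟩⟩

theorem LowerUni.eq_one {a : Matrix (Fin 1) (Fin 1) F} (ha : LowerUni a) : a = 1 := by
  ext i j
  rw [Subsingleton.elim j i, ha.1, one_apply_eq]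

theorem isRigid_one_dim (Y : Matrix (Fin 1) (Fin 1) F) : IsRigid Y := fun _ ha _ => ha.eq_one

theorem numLowerUni_one : numLowerUni F 1 = 1 := by
  rw [numLowerUni, Nat.card_eq_one_iff_unique]
  exact ⟨⟨fun a b => Subtype.ext (a.2.eq_one.trans b.2.eq_one.symm)⟩, ⟨⟨1, lowerUni_one⟩⟩⟩

theorem numRigid_zero : numRigid F 0 = 1 := by
  rw [numRigid, Nat.card_eq_one_iff_unique]
  exact ⟨⟨fun a b => Subtype.ext (Subsingleton.elim _ _)⟩,
    ⟨⟨1, isSymm_one, fun a _ _ => Subsingleton.elim _ _⟩⟩⟩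

theorem numRigid_one [Finite F] : numRigid F 1 = Nat.card F := by
  rw [numRigid]
  refine Nat.card_congr ⟨fun Y => Y.1 0 0, fun c => ⟨of fun _ _ => c, ?_, isRigid_one_dim _⟩,
    fun Y => ?_, fun c => rfl⟩
  · ext i j; rfl
  · ext i j
    rw [Subsingleton.elim i 0, Subsingleton.elim j 0]
    rfl

theorem numLowerUni_add_two [Finite F] :
    numLowerUni F (n + 2) = Nat.card F ^ (n + 1) * numLowerUni F (n + 1) ∧
    numLowerUni F (n + 2) = Nat.card F ^ (2 * n + 1) * numLowerUni F n := by
  constructor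
  · rw [show n + 2 = 1 + (n + 1) by ring, numLowerUni_add, numLowerUni_one, mul_one, one_mul]
  · rw [show n + 2 = 1 + (1 + n) by ring, numLowerUni_add, numLowerUni_add, numLowerUni_one]
    ring

/-- There are v invertible 1×1 blocks and v·q blocks with rows (0, b), (b, c) and b ≠ 0; the shears
contribute q^(n+1) and q^(2n) respectively. -/
theorem numRigid_add_two [Finite F] (h2 : (2 : F) ≠ 0) {v : ℕ} (hv : Nat.card F = v + 1) :
    numRigid F (n + 2) = v * Nat.card F ^ (n + 1) * numRigid F (n + 1) +
      v * Nat.card F ^ (2 * n + 1) * numRigid F n := by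
  have hu : Nat.card {c : F // c ≠ 0} = v := by
    rw [← Nat.card_congr (unitsEquivNeZero (G₀ := F)), Nat.card_units, hv, Nat.add_sub_cancel]
  have h1 := card_rigid_leading (p := n + 1) {H : Matrix (Fin 1) (Fin 1) F | H 0 0 ≠ 0}
    (fun H hH => ⟨by ext i j; rw [Subsingleton.elim i j]; rfl, by simpa using hH,
      isRigid_one_dim H⟩) (N := n + 2) (by ring) (by omega)
  have c1 : Nat.card {H : Matrix (Fin 1) (Fin 1) F | H 0 0 ≠ 0} = v := by
    rw [← hu]
    refine Nat.card_congr ⟨fun H => ⟨H.1 0 0, H.2⟩, fun c => ⟨of fun _ _ => c.1, c.2⟩,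
      fun H => ?_, fun c => rfl⟩
    ext i j
    rw [Subsingleton.elim i 0, Subsingleton.elim j 0]
    rfl
  have h3 := card_rigid_leading (p := n)
    {H : Matrix (Fin 2) (Fin 2) F | H.IsSymm ∧ H 0 0 = 0 ∧ H 0 1 ≠ 0}
    (fun H hH => by
      obtain ⟨hs, h00, h01⟩ := hH
      have h10 : H 1 0 = H 0 1 := hs.apply _ _
      refine ⟨hs, ?_, ?_⟩
      · rw [det_fin_two, h00, h10, isUnit_iff_ne_zero]
        simpa using h01
      · intro a ha e
        -- The (1, 1) entry of a H aᵀ = H reads 2 H₀₁ a₁₀ = 0.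
        have e' := congrFun (congrFun e 1) 1
        have a01 : a 0 1 = 0 := ha.2 0 1 (by decide)
        simp [mul_apply, Fin.sum_univ_two, h00, h10, ha.1] at e'
        have h4 : (2 : F) * H 0 1 * a 1 0 = 0 := by linear_combination e'
        have a10 : a 1 0 = 0 := by simpa [h2, h01] using h4
        ext i j
        fin_cases i <;> fin_cases j <;> simp [ha.1, a01, a10]) (N := n + 2) (by ring) (by omega)
  have c3 : Nat.card {H : Matrix (Fin 2) (Fin 2) F | H.IsSymm ∧ H 0 0 = 0 ∧ H 0 1 ≠ 0} =
      v * Nat.card F := by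
    rw [← hu, ← Nat.card_prod]
    refine Nat.card_congr ⟨fun H => ⟨⟨H.1 0 1, H.2.2.2⟩, H.1 1 1⟩,
      fun c => ⟨!![0, c.1.1; c.1.1, c.2], ?_, rfl, c.1.2⟩, fun H => ?_, fun c => rfl⟩
    · ext i j
      fin_cases i <;> fin_cases j <;> rfl
    · obtain ⟨H, hs, h00, h01⟩ := H
      have h10 : H 1 0 = H 0 1 := hs.apply _ _
      ext i j
      fin_cases i <;> fin_cases j <;> simp [h00, h10]
  rw [c1] at h1
  rw [c3] at h3
  have hsplit : numRigid F (n + 2) =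
      Nat.card {Y : Matrix (Fin (n + 2)) (Fin (n + 2)) F // (Y.IsSymm ∧ IsRigid Y) ∧
        Y.submatrix (Fin.castLE (by omega)) (Fin.castLE (by omega)) ∈
          {H : Matrix (Fin 1) (Fin 1) F | H 0 0 ≠ 0}} +
      Nat.card {Y : Matrix (Fin (n + 2)) (Fin (n + 2)) F // (Y.IsSymm ∧ IsRigid Y) ∧
        Y.submatrix (Fin.castLE (by omega)) (Fin.castLE (by omega)) ∈
          {H : Matrix (Fin 2) (Fin 2) F | H.IsSymm ∧ H 0 0 = 0 ∧ H 0 1 ≠ 0}} := by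
    classical
    have := Fintype.ofFinite F
    rw [numRigid, Nat.card_eq_fintype_card, Nat.card_eq_fintype_card, Nat.card_eq_fintype_card,
      ← Fintype.card_subtype_or_disjoint]
    · refine Fintype.card_congr (Equiv.subtypeEquivRight fun Y => ?_)
      have z1 : Fin.castLE (by omega : 1 ≤ n + 2) 0 = 0 := rfl
      have z2 : Fin.castLE (by omega : 2 ≤ n + 2) 0 = 0 := rfl
      have z3 : Fin.castLE (by omega : 2 ≤ n + 2) 1 = 1 := rfl
      simp only [Set.mem_ofPred_eq, submatrix_apply, z1, z2, z3]
      constructor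
      · rintro ⟨hs, hr⟩
        by_cases h0 : Y 0 0 = 0
        · exact Or.inr ⟨⟨hs, hr⟩, hs.submatrix _, h0,
            fun h => not_isRigid_of_leading_zero h2 hs h0 h hr⟩
        · exact Or.inl ⟨⟨hs, hr⟩, h0⟩
      · rintro (h | h) <;> exact h.1
    · rw [Pi.disjoint_iff]
      intro Y
      rw [Prop.disjoint_iff]
      rintro ⟨h, h'⟩
      exact h.2 h'.2.2.1
  rw [hsplit, h1, h3]
  ring

end Count

/-! ### Coordinates on 𝔲 and its dual. -/

section Orbits

variable {n : ℕ} {F : Type*} [Field F]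

/-- The element of `𝔲` with given diagonal and lower left blocks. -/
def nilElt {A C : Matrix (Fin n) (Fin n) F} (hA : StrictLower A) (hC : C.IsSymm) :
    nilAlgebra n F :=
  ⟨fromBlocks A 0 C (-Aᵀ), by
    rw [mem_nilAlgebra_iff, skew_iff]
    refine ⟨?_, fun i j => hC.apply i j, fun i j => rfl, fun i j => rfl⟩
    rintro (a | a) (b | b) hab <;> simp only [pos] at hab
    · exact hA a b hab
    · rfl
    · omega
    · simp [hA b a (Fin.le_def.2 (by omega))]⟩

theorem exists_eq_nilElt (x : nilAlgebra n F) :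
    ∃ (A C : Matrix (Fin n) (Fin n) F) (hA : StrictLower A) (hC : C.IsSymm), x = nilElt hA hC := by
  obtain ⟨x, hx⟩ := x
  have hx' := mem_nilAlgebra_iff.1 hx
  rw [skew_iff] at hx'
  obtain ⟨h0, h1, h2, h3⟩ := hx'
  refine ⟨x.toBlocks₁₁, x.toBlocks₂₁, fun i j hij => h0 _ _ hij, ?_, ?_⟩
  · ext i j; exact h1 i j
  · refine Subtype.ext ?_
    ext (a | a) (b | b)
    · rfl
    · exact h0 _ _ (by simp only [pos]; omega)
    · rfl
    · exact h2 a b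

/-- The linear form on `𝔲` attached to a pair of square matrices. -/
def formOf (Y X : Matrix (Fin n) (Fin n) F) : Module.Dual F (nilAlgebra n F) where
  toFun x := (Y * x.1.toBlocks₂₁).trace + (Xᵀ * x.1.toBlocks₁₁).trace
  map_add' x y := by
    have e1 : (x + y).1.toBlocks₂₁ = x.1.toBlocks₂₁ + y.1.toBlocks₂₁ := rfl
    have e2 : (x + y).1.toBlocks₁₁ = x.1.toBlocks₁₁ + y.1.toBlocks₁₁ := rfl
    rw [e1, e2, Matrix.mul_add, Matrix.mul_add, trace_add, trace_add]
    ring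
  map_smul' c x := by
    have e1 : (c • x).1.toBlocks₂₁ = c • x.1.toBlocks₂₁ := rfl
    have e2 : (c • x).1.toBlocks₁₁ = c • x.1.toBlocks₁₁ := rfl
    rw [e1, e2, Matrix.mul_smul, Matrix.mul_smul, trace_smul, trace_smul, smul_add]
    rfl

theorem formOf_nilElt (Y X : Matrix (Fin n) (Fin n) F) {A C : Matrix (Fin n) (Fin n) F}
    (hA : StrictLower A) (hC : C.IsSymm) :
    formOf Y X (nilElt hA hC) = (Y * C).trace + (Xᵀ * A).trace := rfl

theorem strictLower_zero : StrictLower (0 : Matrix (Fin n) (Fin n) F) := fun _ _ _ => rfl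

theorem strictLower_single {i j : Fin n} (h : j < i) :
    StrictLower (single i j 1 : Matrix (Fin n) (Fin n) F) := by
  intro k l hkl
  rw [single_apply, if_neg]
  rintro ⟨rfl, rfl⟩
  exact absurd hkl h.not_ge

theorem isSymm_single_add (i j : Fin n) :
    (single i j 1 + single j i 1 : Matrix (Fin n) (Fin n) F).IsSymm := by
  rw [IsSymm, transpose_add, transpose_single, transpose_single, add_comm]

/-- The trace form is nondegenerate on symmetric matrices. -/
theorem eq_of_trace_symm (h2 : (2 : F) ≠ 0) {Y Y' : Matrix (Fin n) (Fin n) F} (hY : Y.IsSymm)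
    (hY' : Y'.IsSymm) (h : ∀ C : Matrix (Fin n) (Fin n) F, C.IsSymm →
      (Y * C).trace = (Y' * C).trace) : Y = Y' := by
  ext i j
  have := h _ (isSymm_single_add i j)
  simp only [Matrix.mul_add, trace_add, trace_mul_single, hY.apply, hY'.apply] at this
  have h3 : (2 : F) * (Y i j - Y' i j) = 0 := by
    simp at this
    linear_combination this
  exact sub_eq_zero.1 (by simpa [h2] using h3)

theorem eq_of_trace_strictLower {X X' : Matrix (Fin n) (Fin n) F} (hX : StrictLower X)
    (hX' : StrictLower X') (h : ∀ A : Matrix (Fin n) (Fin n) F, StrictLower A →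
      (Xᵀ * A).trace = (X'ᵀ * A).trace) : X = X' := by
  ext i j
  rcases lt_or_ge j i with hij | hij
  · have := h _ (strictLower_single hij)
    simpa [trace_mul_single] using this
  · rw [hX i j hij, hX' i j hij]

theorem formOf_inj (h2 : (2 : F) ≠ 0) {Y Y' X X' : Matrix (Fin n) (Fin n) F} (hY : Y.IsSymm)
    (hY' : Y'.IsSymm) (hX : StrictLower X) (hX' : StrictLower X')
    (h : formOf Y X = formOf Y' X') : Y = Y' ∧ X = X' := by
  constructor
  · refine eq_of_trace_symm h2 hY hY' fun C hC => ?_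
    have := LinearMap.congr_fun h (nilElt strictLower_zero hC)
    simpa [formOf_nilElt] using this
  · refine eq_of_trace_strictLower hX hX' fun A hA => ?_
    have := LinearMap.congr_fun h (nilElt hA isSymm_zero)
    simpa [formOf_nilElt] using this

/-- The strictly lower triangular part of a matrix. -/
def lowerPart (X : Matrix (Fin n) (Fin n) F) : Matrix (Fin n) (Fin n) F :=
  of fun i j => if j < i then X i j else 0

theorem strictLower_lowerPart (X : Matrix (Fin n) (Fin n) F) : StrictLower (lowerPart X) :=
  fun _ _ h => if_neg h.not_gt

theorem trace_lowerPart_mul (X : Matrix (Fin n) (Fin n) F) {A : Matrix (Fin n) (Fin n) F}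
    (hA : StrictLower A) : ((lowerPart X)ᵀ * A).trace = (Xᵀ * A).trace := by
  simp only [trace, diag_apply, mul_apply, transpose_apply, lowerPart, of_apply]
  refine Finset.sum_congr rfl fun i _ => Finset.sum_congr rfl fun j _ => ?_
  split_ifs with h
  · rfl
  · rw [hA j i (not_lt.1 h), mul_zero, mul_zero]

/-- An extension of f to all matrices has the form M ↦ tr(W M). On 𝔲 it equals tr(W₁₂ C) + tr((W₁₁ -
W₂₂ᵀ) A), which depends only on the symmetric part of W₁₂ and the strictly lower part of W₁₁ᵀ - W₂₂.
-/
theorem exists_eq_formOf (h2 : (2 : F) ≠ 0) (f : Module.Dual F (nilAlgebra n F)) :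
    ∃ Y X, Y.IsSymm ∧ StrictLower X ∧ f = formOf Y X := by
  obtain ⟨φ, hφ⟩ := LinearMap.exists_extend f
  set W : Matrix (Idx n) (Idx n) F := of fun a b => φ (single b a 1) with hW
  have hf : ∀ M, φ M = (W * M).trace := by
    intro M
    conv_lhs => rw [matrix_eq_sum_single M]
    simp only [map_sum, trace, diag_apply, mul_apply]
    rw [Finset.sum_comm]
    refine Finset.sum_congr rfl fun i _ => Finset.sum_congr rfl fun j _ => ?_
    rw [show single j i (M j i) = M j i • (single j i 1 : Matrix (Idx n) (Idx n) F) by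
      simp [smul_single], map_smul, hW, of_apply, smul_eq_mul, mul_comm]
  refine ⟨(2 : F)⁻¹ • (W.toBlocks₁₂ + W.toBlocks₁₂ᵀ),
    lowerPart (W.toBlocks₁₁ᵀ - W.toBlocks₂₂), ?_, strictLower_lowerPart _, ?_⟩
  · rw [IsSymm, transpose_smul, transpose_add, transpose_transpose, add_comm]
  · ext x
    obtain ⟨A, C, hA, hC, rfl⟩ := exists_eq_nilElt x
    have e : f (nilElt hA hC) = φ (fromBlocks A 0 C (-Aᵀ)) := by
      rw [← hφ]; rfl
    have t1 : (W.toBlocks₁₂ᵀ * C).trace = (W.toBlocks₁₂ * C).trace := by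
      rw [← trace_transpose, transpose_mul, transpose_transpose, hC.eq, trace_mul_comm]
    have t2 : (W.toBlocks₂₂ * Aᵀ).trace = (W.toBlocks₂₂ᵀ * A).trace := by
      rw [← trace_transpose, transpose_mul, transpose_transpose, trace_mul_comm]
    have htr : ∀ A B C D : Matrix (Fin n) (Fin n) F,
        (fromBlocks A B C D).trace = A.trace + D.trace := fun A B C D => by simp [trace]
    rw [e, hf, formOf_nilElt, trace_lowerPart_mul _ hA]
    conv_lhs => rw [← fromBlocks_toBlocks W]
    rw [fromBlocks_multiply, htr, Matrix.smul_mul, trace_smul, Matrix.add_mul,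
      trace_add, transpose_sub, transpose_transpose, Matrix.sub_mul, trace_sub, trace_add,
      trace_add, Matrix.mul_neg, trace_neg, t1, t2]
    simp
    field_simp
    ring

end Orbits

end SymplecticUnipotent

namespace SymplecticUnipotent

/-! ### From infinitesimal rigidity to transitivity, by duality. -/

section Orbits

variable {n : ℕ} {F : Type*} [Field F]

/-- Rigidity makes the translation part of the coadjoint action transitive on the second
component. -/
theorem IsRigid.exists_symm_lowerPart [Finite F] (h2 : (2 : F) ≠ 0)
    {Y : Matrix (Fin n) (Fin n) F} (hs : Y.IsSymm) (hY : IsRigid Y)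
    (X : Matrix (Fin n) (Fin n) F) : ∃ c, c.IsSymm ∧ lowerPart (c * Y) = lowerPart X := by
  let P : Submodule F (Matrix (Fin n) (Fin n) F) :=
    { carrier := {M | ∃ c, c.IsSymm ∧ lowerPart (c * Y) = lowerPart M}
      zero_mem' := ⟨0, isSymm_zero, by rw [Matrix.zero_mul]⟩
      add_mem' := by
        rintro M M' ⟨c, hc, e⟩ ⟨c', hc', e'⟩
        refine ⟨c + c', hc.add hc', ?_⟩
        ext i j
        have e1 := congrFun (congrFun e i) j
        have e2 := congrFun (congrFun e' i) j
        simp only [lowerPart, of_apply, Matrix.add_mul, Matrix.add_apply] at e1 e2 ⊢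
        split_ifs at e1 e2 ⊢ with h
        · rw [e1, e2]
        · rfl
      smul_mem' := by
        rintro k M ⟨c, hc, e⟩
        refine ⟨k • c, hc.smul k, ?_⟩
        ext i j
        have e1 := congrFun (congrFun e i) j
        simp only [lowerPart, of_apply, Matrix.smul_mul, Matrix.smul_apply] at e1 ⊢
        split_ifs at e1 ⊢ with h
        · rw [e1]
        · rfl }
  -- Otherwise a functional M ↦ tr(Bᵀ M) vanishes on `P` but not at X. As `P` contains all matrices
  -- without strictly lower part (take c = 0), B is strictly lower triangular.
  by_contra hX
  have hX' : X ∉ P := hX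
  obtain ⟨φ, hφ, hP⟩ := Submodule.exists_le_ker_of_notMem hX'
  set B : Matrix (Fin n) (Fin n) F := of fun a b => φ (single a b 1) with hB
  have hf : ∀ M, φ M = (Bᵀ * M).trace := by
    intro M
    conv_lhs => rw [matrix_eq_sum_single M]
    simp only [map_sum, trace, diag_apply, mul_apply]
    rw [Finset.sum_comm]
    refine Finset.sum_congr rfl fun i _ => Finset.sum_congr rfl fun j _ => ?_
    rw [show single j i (M j i) = M j i • (single j i 1 : Matrix (Fin n) (Fin n) F) by
      simp [smul_single], map_smul, hB, transpose_apply, of_apply, smul_eq_mul, mul_comm]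
  have hlow : StrictLower B := by
    intro i j hij
    refine hP (show single i j 1 ∈ P from ⟨0, isSymm_zero, ?_⟩)
    ext k l
    simp only [lowerPart, of_apply, Matrix.zero_mul, Matrix.zero_apply, single_apply]
    split_ifs with h h'
    · obtain ⟨rfl, rfl⟩ := h'
      exact absurd hij h.not_ge
    · rfl
    · rfl
  have hB0 : B = 0 := by
    -- Vanishing on C Y for every symmetric C means tr((B Y + Y Bᵀ) C) = 0, so the symmetric matrix
    -- B Y + Y Bᵀ is zero.
    refine hY.eq_zero_of_skew h2 hlow (eq_of_trace_symm h2 ?_ isSymm_zero fun C hC => ?_)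
    · rw [IsSymm, transpose_add, transpose_mul, transpose_mul, transpose_transpose, hs.eq,
        add_comm]
    · have h1 : (Bᵀ * (C * Y)).trace = 0 := by
        rw [← hf]
        exact hP (show C * Y ∈ P from ⟨C, hC, rfl⟩)
      have h3 : (Y * Bᵀ * C).trace = 0 := by
        rw [← h1, Matrix.mul_assoc, trace_mul_comm, Matrix.mul_assoc]
      have h4 : (B * Y * C).trace = 0 := by
        rw [← h1, ← trace_transpose, transpose_mul, transpose_mul, hC.eq, hs.eq,
          trace_mul_comm, Matrix.mul_assoc, trace_mul_comm, Matrix.mul_assoc,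
          ← Matrix.mul_assoc, trace_mul_comm]
      rw [Matrix.add_mul, trace_add, h3, h4, Matrix.zero_mul, trace_zero, add_zero]
  refine hφ ?_
  rw [hf, hB0, transpose_zero, Matrix.zero_mul, trace_zero]

/-! ### The coadjoint action -/

/-- The underlying matrix of an element of `U`. -/
def mat (g : unipotentSubgroup n F) : Matrix (Idx n) (Idx n) F :=
  (g : Matrix.symplecticGroup (Fin n) F)

theorem exists_mat_eq (g : unipotentSubgroup n F) :
    ∃ a c d : Matrix (Fin n) (Fin n) F, LowerUni a ∧ mat g = fromBlocks a 0 c d := by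
  have hg : IsLowerUnitriangular (mat g) := g.2
  refine ⟨(mat g).toBlocks₁₁, (mat g).toBlocks₂₁, (mat g).toBlocks₂₂,
    ⟨fun i => hg.1 _, fun i j h => hg.2 _ _ h⟩, ?_⟩
  conv_lhs => rw [← fromBlocks_toBlocks (mat g)]
  congr 1
  ext i j
  exact hg.2 _ _ (by simp only [pos]; omega)

theorem mat_inv {g : unipotentSubgroup n F} {a c d : Matrix (Fin n) (Fin n) F}
    (h : mat g = fromBlocks a 0 c d) : mat g⁻¹ = fromBlocks dᵀ 0 (-cᵀ) aᵀ := by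
  have : mat g⁻¹ = -(Matrix.J (Fin n) F) * (mat g)ᵀ * Matrix.J (Fin n) F :=
    SymplecticGroup.coe_inv _
  rw [this, h]
  simp [Matrix.J, fromBlocks_transpose, fromBlocks_multiply, fromBlocks_neg]

theorem coadjointRep_formOf_nilElt {g : unipotentSubgroup n F} {a c d : Matrix (Fin n) (Fin n) F}
    (h : mat g = fromBlocks a 0 c d) (Y X : Matrix (Fin n) (Fin n) F)
    {A C : Matrix (Fin n) (Fin n) F} (hA : StrictLower A) (hC : C.IsSymm) :
    coadjointRep n F g (formOf Y X) (nilElt hA hC) =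
      (Y * ((-cᵀ * A + aᵀ * C) * a - aᵀ * Aᵀ * c)).trace + (Xᵀ * (dᵀ * A * a)).trace := by
  have e : (adjointRep n F g⁻¹ (nilElt hA hC)).1 =
      fromBlocks (dᵀ * A * a) 0 ((-cᵀ * A + aᵀ * C) * a - aᵀ * Aᵀ * c) (-(aᵀ * Aᵀ * d)) := by
    change mat g⁻¹ * fromBlocks A 0 C (-Aᵀ) * mat g⁻¹⁻¹ = _
    rw [inv_inv, mat_inv h, h, fromBlocks_multiply, fromBlocks_multiply]
    simp [sub_eq_add_neg]
  change formOf Y X (adjointRep n F g⁻¹ (nilElt hA hC)) = _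
  simp only [formOf, LinearMap.coe_mk, AddHom.coe_mk]
  rw [e, toBlocks_fromBlocks₂₁, toBlocks_fromBlocks₁₁]

theorem isSymm_congr {Y : Matrix (Fin n) (Fin n) F} (hY : Y.IsSymm)
    (a : Matrix (Fin n) (Fin n) F) : (a * Y * aᵀ).IsSymm := by
  rw [IsSymm, transpose_mul, transpose_mul, transpose_transpose, hY.eq, Matrix.mul_assoc]

/-- On elements of 𝔲 with A = 0, conjugation by g⁻¹ replaces C by aᵀ C a, which determines the
symmetric component of the new form. -/
theorem exists_coadjointRep_formOf (h2 : (2 : F) ≠ 0) {g : unipotentSubgroup n F}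
    {a c d : Matrix (Fin n) (Fin n) F} (h : mat g = fromBlocks a 0 c d)
    {Y : Matrix (Fin n) (Fin n) F} (hY : Y.IsSymm) (X : Matrix (Fin n) (Fin n) F) :
    ∃ X', StrictLower X' ∧ coadjointRep n F g (formOf Y X) = formOf (a * Y * aᵀ) X' := by
  obtain ⟨Y', X', hY', hX', e⟩ := exists_eq_formOf h2 (coadjointRep n F g (formOf Y X))
  refine ⟨X', hX', ?_⟩
  rw [e]
  congr 1
  refine eq_of_trace_symm h2 hY' (isSymm_congr hY a) fun C hC => ?_
  · have e1 := LinearMap.congr_fun e (nilElt strictLower_zero hC)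
    rw [coadjointRep_formOf_nilElt h, formOf_nilElt] at e1
    simp only [Matrix.mul_zero, Matrix.zero_mul, zero_add, trace_zero, add_zero, transpose_zero,
      sub_zero] at e1
    have e2 : a * Y * aᵀ * C = a * (Y * (aᵀ * C)) := by simp only [Matrix.mul_assoc]
    rw [← e1, e2, trace_mul_comm a]
    simp only [Matrix.mul_assoc]

/-- The two equations are the symplectic condition for a block lower triangular matrix. The cases
needed are c = 0, and a = d = 1 with c symmetric. -/
theorem exists_mat_eq_fromBlocks {a c d : Matrix (Fin n) (Fin n) F} (ha : LowerUni a)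
    (hd : LowerUni dᵀ) (h : a * dᵀ = 1) (hc : d * cᵀ = c * dᵀ) :
    ∃ g : unipotentSubgroup n F, mat g = fromBlocks a 0 c d := by
  have h' : d * aᵀ = 1 := by rw [← transpose_inj, transpose_mul, transpose_transpose, h,
    transpose_one]
  refine ⟨⟨⟨fromBlocks a 0 c d, ?_⟩, ?_, ?_⟩, rfl⟩
  · rw [SymplecticGroup.mem_iff]
    simp [Matrix.J, fromBlocks_transpose, fromBlocks_multiply, h, h', hc]
  · rintro (i | i)
    · exact ha.1 i
    · exact hd.1 i
  · rintro (i | i) (j | j) hij <;> simp only [pos] at hij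
    · exact ha.2 i j hij
    · rfl
    · omega
    · exact hd.2 j i (Fin.lt_def.2 (by omega))

theorem self_mem_coadjointOrbit (f : Module.Dual F (nilAlgebra n F)) : f ∈ coadjointOrbit f :=
  ⟨1, by simp only [map_one]; rfl⟩

theorem coadjointOrbit_eq_of_mem {f f' : Module.Dual F (nilAlgebra n F)}
    (h : f' ∈ coadjointOrbit f) : coadjointOrbit f' = coadjointOrbit f := by
  obtain ⟨g, rfl⟩ := h
  ext x
  constructor
  · rintro ⟨k, rfl⟩
    exact ⟨k * g, by simp only [map_mul]; rfl⟩
  · rintro ⟨k, rfl⟩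
    refine ⟨k * g⁻¹, ?_⟩
    change ((coadjointRep n F (k * g⁻¹)) * (coadjointRep n F g)) f = _
    rw [← map_mul, inv_mul_cancel_right]

/-! ### Orbit sizes and the count of maximal orbits. -/

/-- The forms that may occur in the coadjoint orbit of `formOf Y X`. -/
def orbitMap (Y : Matrix (Fin n) (Fin n) F) (t : {a : Matrix (Fin n) (Fin n) F // LowerUni a} ×
    {X : Matrix (Fin n) (Fin n) F // StrictLower X}) : Module.Dual F (nilAlgebra n F) :=
  formOf (t.1.1 * Y * t.1.1ᵀ) t.2.1

theorem coadjointOrbit_subset (h2 : (2 : F) ≠ 0) {Y : Matrix (Fin n) (Fin n) F} (hY : Y.IsSymm)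
    (X : Matrix (Fin n) (Fin n) F) : coadjointOrbit (formOf Y X) ⊆ Set.range (orbitMap Y) := by
  rintro _ ⟨g, rfl⟩
  obtain ⟨a, c, d, ha, h⟩ := exists_mat_eq g
  obtain ⟨X', hX', e⟩ := exists_coadjointRep_formOf h2 h hY X
  exact ⟨⟨⟨a, ha⟩, ⟨X', hX'⟩⟩, e.symm⟩

theorem coadjointOrbit_eq_range [Finite F] (h2 : (2 : F) ≠ 0) {Y : Matrix (Fin n) (Fin n) F}
    (hY : Y.IsSymm) (hr : IsRigid Y) (X : Matrix (Fin n) (Fin n) F) :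
    coadjointOrbit (formOf Y X) = Set.range (orbitMap Y) := by
  refine (coadjointOrbit_subset h2 hY X).antisymm ?_
  rintro _ ⟨⟨⟨a, ha⟩, ⟨X', hX'⟩⟩, rfl⟩
  obtain ⟨b, hb, hab, hba⟩ := ha.exists_inv
  obtain ⟨g, hg⟩ := exists_mat_eq_fromBlocks (c := 0) (d := bᵀ) ha (by simpa using hb)
    (by simpa using hab) (by simp)
  obtain ⟨X₁, hX₁, e₁⟩ := exists_coadjointRep_formOf h2 hg hY X
  -- The block diagonal element `g` has produced a Y aᵀ. The element with blocks 1, c, 1 fixes it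
  -- and subtracts twice the lower part of c (a Y aᵀ) from X₁, whence the factor 1/2.
  obtain ⟨c, hc, ec⟩ := (hr.congr ha).exists_symm_lowerPart h2 (isSymm_congr hY a)
    ((2 : F)⁻¹ • (X₁ - X'))
  obtain ⟨k, hk⟩ := exists_mat_eq_fromBlocks (a := 1) (c := c) (d := 1) lowerUni_one
    (by simpa using lowerUni_one) (by simp) (by simp [hc.eq])
  have e₂ : coadjointRep n F k (formOf (a * Y * aᵀ) X₁) = formOf (a * Y * aᵀ) X' := by
    ext x
    obtain ⟨A, C, hA, hC, rfl⟩ := exists_eq_nilElt x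
    have hZ := isSymm_congr hY a
    generalize a * Y * aᵀ = Z at hZ ec
    rw [coadjointRep_formOf_nilElt hk, formOf_nilElt]
    have t1 : (Z * (Aᵀ * c)).trace = (Z * (c * A)).trace := by
      rw [← trace_transpose, transpose_mul, transpose_mul, transpose_transpose, hZ.eq, hc.eq,
        trace_mul_comm]
    have t2 : (Z * (c * A)).trace = (2 : F)⁻¹ * ((X₁ᵀ * A).trace - (X'ᵀ * A).trace) := by
      calc (Z * (c * A)).trace = ((c * Z)ᵀ * A).trace := by
            rw [transpose_mul, hZ.eq, hc.eq, Matrix.mul_assoc]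
        _ = _ := by
            rw [← trace_lowerPart_mul _ hA, ec, trace_lowerPart_mul _ hA, transpose_smul,
              transpose_sub, Matrix.smul_mul, trace_smul, Matrix.sub_mul, trace_sub, smul_eq_mul]
    simp only [transpose_one, Matrix.one_mul, Matrix.mul_one, hc.eq, Matrix.mul_sub,
      Matrix.mul_add, Matrix.neg_mul, Matrix.mul_neg, trace_sub, trace_add, trace_neg, t1, t2]
    field_simp
    ring
  refine ⟨k * g, ?_⟩
  change coadjointRep n F (k * g) _ = _
  rw [map_mul, Module.End.mul_apply, e₁, e₂]
  rfl

/-- Since a form determines its pair (Y, X), only injectivity of a ↦ a Y aᵀ matters, and this is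
triviality of the stabilizer. -/
theorem orbitMap_injective_iff [Finite F] (h2 : (2 : F) ≠ 0) {Y : Matrix (Fin n) (Fin n) F}
    (hY : Y.IsSymm) : Function.Injective (orbitMap Y) ↔ IsRigid Y := by
  constructor
  · intro h a ha e
    have := @h (⟨a, ha⟩, ⟨0, strictLower_zero⟩) (⟨1, lowerUni_one⟩, ⟨0, strictLower_zero⟩)
      (by simp [orbitMap, e])
    simpa using this
  · rintro hr ⟨⟨a, ha⟩, ⟨X, hX⟩⟩ ⟨⟨a', ha'⟩, ⟨X', hX'⟩⟩ h
    obtain ⟨e, rfl⟩ := formOf_inj h2 (isSymm_congr hY a) (isSymm_congr hY a') hX hX' h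
    obtain ⟨b, hb, hab, hba⟩ := ha'.exists_inv
    have hbt : a'ᵀ * bᵀ = 1 := by rw [← transpose_mul, hba, transpose_one]
    have := hr (b * a) (hb.mul ha) (by
      calc b * a * Y * (b * a)ᵀ = b * (a * Y * aᵀ) * bᵀ := by
            simp only [transpose_mul, Matrix.mul_assoc]
        _ = (b * a') * Y * (a'ᵀ * bᵀ) := by rw [e]; simp only [Matrix.mul_assoc]
        _ = Y := by rw [hba, hbt, Matrix.one_mul, Matrix.mul_one])
    have : a = a' := by
      calc a = a' * (b * a) := by rw [← Matrix.mul_assoc, hab, Matrix.one_mul]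
        _ = a' := by rw [this, Matrix.mul_one]
    subst this
    rfl

variable (F) in
/-- The number of strictly lower triangular matrices. -/
noncomputable def numStrictLower (n : ℕ) : ℕ :=
  Nat.card {X : Matrix (Fin n) (Fin n) F // StrictLower X}

theorem numStrictLower_pos [Finite F] : 0 < numStrictLower F n :=
  have : Nonempty {a : Matrix (Fin n) (Fin n) F // StrictLower a} := ⟨⟨0, strictLower_zero⟩⟩
  Nat.card_pos

instance [Finite F] : Finite (Module.Dual F (nilAlgebra n F)) :=
  Module.finite_of_finite F

theorem card_coadjointOrbit_le [Finite F] (h2 : (2 : F) ≠ 0) {Y : Matrix (Fin n) (Fin n) F}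
    (hY : Y.IsSymm) (X : Matrix (Fin n) (Fin n) F) :
    Nat.card (coadjointOrbit (formOf Y X)) ≤ numLowerUni F n * numStrictLower F n :=
  calc Nat.card (coadjointOrbit (formOf Y X)) ≤ Nat.card (Set.range (orbitMap Y)) :=
        Nat.card_mono (Set.toFinite _) (coadjointOrbit_subset h2 hY X)
    _ ≤ _ := Finite.card_range_le _
    _ = _ := Nat.card_prod _ _

theorem card_coadjointOrbit_eq_iff [Finite F] (h2 : (2 : F) ≠ 0) {Y : Matrix (Fin n) (Fin n) F}
    (hY : Y.IsSymm) (X : Matrix (Fin n) (Fin n) F) :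
    Nat.card (coadjointOrbit (formOf Y X)) = numLowerUni F n * numStrictLower F n ↔
      IsRigid Y := by
  constructor
  · intro h
    rw [← orbitMap_injective_iff h2 hY, ← Set.injOn_univ]
    -- An orbit of full size leaves no room for the range containing it to be smaller than the
    -- domain of `orbitMap Y`.
    refine Set.injOn_of_ncard_image_eq ?_ (Set.toFinite _)
    refine (Set.ncard_image_le (Set.toFinite _)).antisymm ?_
    rw [Set.ncard_univ, Nat.card_prod, Set.image_univ]
    exact h.symm.le.trans (Nat.card_mono (Set.toFinite _) (coadjointOrbit_subset h2 hY X))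
  · intro h
    rw [coadjointOrbit_eq_range h2 hY h,
      Nat.card_range_of_injective ((orbitMap_injective_iff h2 hY).2 h), Nat.card_prod]
    rfl

theorem orbitDim_le_iff [Finite F] (f f' : Module.Dual F (nilAlgebra n F)) :
    orbitDim (coadjointOrbit f) ≤ orbitDim (coadjointOrbit f') ↔
      Nat.card (coadjointOrbit f) ≤ Nat.card (coadjointOrbit f') := by
  have hpos : ∀ f : Module.Dual F (nilAlgebra n F), (0 : ℝ) < Nat.card (coadjointOrbit f) :=
    fun f => by
      have : Nonempty (coadjointOrbit f) := ⟨⟨f, self_mem_coadjointOrbit f⟩⟩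
      exact_mod_cast Nat.card_pos
  rw [orbitDim, orbitDim, Real.logb_le_logb (by exact_mod_cast Finite.one_lt_card) (hpos f)
    (hpos f'), Nat.cast_le]

theorem coadjointOrbit_mem_maxDimOrbits_iff [Finite F] (h2 : (2 : F) ≠ 0)
    {Y : Matrix (Fin n) (Fin n) F} (hY : Y.IsSymm) (X : Matrix (Fin n) (Fin n) F) :
    coadjointOrbit (formOf Y X) ∈ maxDimOrbits n F ↔ IsRigid Y := by
  rw [← card_coadjointOrbit_eq_iff h2 hY X]
  constructor
  · rintro ⟨-, h⟩
    refine (card_coadjointOrbit_le h2 hY X).antisymm ?_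
    -- The orbit of the pair (1, 0) attains the upper bound, so a maximal orbit does too.
    rw [← (card_coadjointOrbit_eq_iff h2 isSymm_one 0).2 isRigid_one, ← orbitDim_le_iff]
    exact h _ ⟨_, rfl⟩
  · intro h
    refine ⟨⟨_, rfl⟩, ?_⟩
    rintro _ ⟨f, rfl⟩
    obtain ⟨Y', X', hY', hX', rfl⟩ := exists_eq_formOf h2 f
    rw [orbitDim_le_iff, h]
    exact card_coadjointOrbit_le h2 hY' X'

/-- The orbits of maximal dimension are counted by rigid symmetric matrices. -/
theorem numMaxDimOrbits_mul [Finite F] (h2 : (2 : F) ≠ 0) :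
    numMaxDimOrbits n F * numLowerUni F n = numRigid F n := by
  have hmem : ∀ Ω ∈ maxDimOrbits n F, ∀ f ∈ Ω, coadjointOrbit f = Ω := by
    rintro _ ⟨⟨f, rfl⟩, -⟩ f' hf'
    exact coadjointOrbit_eq_of_mem hf'
  have hcard : ∀ Ω : maxDimOrbits n F,
      Nat.card Ω.1 = numLowerUni F n * numStrictLower F n := by
    rintro ⟨_, ⟨f, rfl⟩, h⟩
    obtain ⟨Y, X, hY, hX, rfl⟩ := exists_eq_formOf h2 f
    rw [card_coadjointOrbit_eq_iff h2 hY, ← coadjointOrbit_mem_maxDimOrbits_iff h2 hY X]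
    exact ⟨⟨_, rfl⟩, h⟩
  -- Forms in maximal orbits are counted twice: here by orbits, all of size L·T, and in `e2` by
  -- pairs of a rigid Y and an arbitrary X. The factor T cancels.
  have e1 : Nat.card (Σ Ω : maxDimOrbits n F, Ω.1) =
      Nat.card {f : Module.Dual F (nilAlgebra n F) // coadjointOrbit f ∈ maxDimOrbits n F} := by
    refine Nat.card_congr (Equiv.ofBijective
      (fun t => ⟨t.2.1, by rw [hmem _ t.1.2 _ t.2.2]; exact t.1.2⟩) ⟨?_, ?_⟩)
    · rintro ⟨⟨Ω, hΩ⟩, ⟨f, hf⟩⟩ ⟨⟨Ω', hΩ'⟩, ⟨f', hf'⟩⟩ h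
      obtain rfl : f = f' := congrArg Subtype.val h
      obtain rfl : Ω = Ω' := (hmem _ hΩ _ hf).symm.trans (hmem _ hΩ' _ hf')
      rfl
    · rintro ⟨f, hf⟩
      exact ⟨⟨⟨_, hf⟩, ⟨f, self_mem_coadjointOrbit f⟩⟩, rfl⟩
  have e2 : Nat.card ({Y : Matrix (Fin n) (Fin n) F // Y.IsSymm ∧ IsRigid Y} ×
      {X : Matrix (Fin n) (Fin n) F // StrictLower X}) =
      Nat.card {f : Module.Dual F (nilAlgebra n F) // coadjointOrbit f ∈ maxDimOrbits n F} := by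
    refine Nat.card_congr (Equiv.ofBijective (fun t => ⟨formOf t.1.1 t.2.1,
      (coadjointOrbit_mem_maxDimOrbits_iff h2 t.1.2.1 _).2 t.1.2.2⟩) ⟨?_, ?_⟩)
    · rintro ⟨⟨Y, hY⟩, ⟨X, hX⟩⟩ ⟨⟨Y', hY'⟩, ⟨X', hX'⟩⟩ h
      obtain ⟨rfl, rfl⟩ := formOf_inj h2 hY.1 hY'.1 hX hX' (congrArg Subtype.val h)
      rfl
    · rintro ⟨f, hf⟩
      obtain ⟨Y, X, hY, hX, rfl⟩ := exists_eq_formOf h2 f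
      exact ⟨⟨⟨Y, hY, (coadjointOrbit_mem_maxDimOrbits_iff h2 hY X).1 hf⟩, ⟨X, hX⟩⟩, rfl⟩
  have := Fintype.ofFinite (maxDimOrbits n F)
  rw [Nat.card_sigma, Finset.sum_congr rfl fun Ω _ => hcard Ω, Finset.sum_const, smul_eq_mul,
    Finset.card_univ, ← Nat.card_eq_fintype_card, ← e2, Nat.card_prod] at e1
  refine Nat.eq_of_mul_eq_mul_right (numStrictLower_pos (F := F) (n := n)) ?_
  rw [mul_assoc]
  exact e1

theorem numMaxDimOrbits_zero [Finite F] (h2 : (2 : F) ≠ 0) : numMaxDimOrbits 0 F = 1 := by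
  simpa [numLowerUni_zero, numRigid_zero] using numMaxDimOrbits_mul (n := 0) h2

theorem numMaxDimOrbits_one [Finite F] (h2 : (2 : F) ≠ 0) :
    numMaxDimOrbits 1 F = Nat.card F := by
  simpa [numLowerUni_one, numRigid_one] using numMaxDimOrbits_mul (n := 1) h2

/-- The powers of q in the recursion for rigid matrices are exactly the ratios of the orders of the
unitriangular groups, so dividing by the largest order removes them. -/
theorem numMaxDimOrbits_add_two [Finite F] (h2 : (2 : F) ≠ 0) {v : ℕ} (hv : Nat.card F = v + 1) :
    numMaxDimOrbits (n + 2) F = v * numMaxDimOrbits (n + 1) F + v * numMaxDimOrbits n F := by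
  refine Nat.eq_of_mul_eq_mul_right (numLowerUni_pos (F := F) (n := n + 2)) ?_
  rw [numMaxDimOrbits_mul h2, numRigid_add_two h2 hv, ← numMaxDimOrbits_mul h2,
    ← numMaxDimOrbits_mul h2, add_mul]
  have e1 := (numLowerUni_add_two (F := F) (n := n)).1
  have e2 := (numLowerUni_add_two (F := F) (n := n)).2
  calc _ = v * numMaxDimOrbits (n + 1) F * (Nat.card F ^ (n + 1) * numLowerUni F (n + 1)) +
        v * numMaxDimOrbits n F * (Nat.card F ^ (2 * n + 1) * numLowerUni F n) := by ring
    _ = _ := by rw [← e1, ← e2]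

end Orbits

/-! ### Closed form and polynomiality. -/

/-- The polynomials expressing the numbers of orbits of maximal dimension through `v = q - 1`. -/
noncomputable def orbitPoly : ℕ → Polynomial ℕ
  | 0 => 1
  | 1 => Polynomial.X + 1
  | n + 2 => Polynomial.X * orbitPoly (n + 1) + Polynomial.X * orbitPoly n

/-- Binet's formula for the recursion of the numbers of orbits of maximal dimension. -/
theorem binet_of_recursion {S : ℕ → ℝ} {v : ℝ} (hv : 0 < v) (h0 : S 0 = 1) (h1 : S 1 = v + 1)
    (h : ∀ n, S (n + 2) = v * S (n + 1) + v * S n) (n : ℕ) :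
    S n = ((v + 2 + √(v ^ 2 + 4 * v)) / (2 * √(v ^ 2 + 4 * v))) *
              ((v + √(v ^ 2 + 4 * v)) / 2) ^ n +
            ((-v - 2 + √(v ^ 2 + 4 * v)) / (2 * √(v ^ 2 + 4 * v))) *
              ((v - √(v ^ 2 + 4 * v)) / 2) ^ n := by
  have hD : √(v ^ 2 + 4 * v) ^ 2 = v ^ 2 + 4 * v := Real.sq_sqrt (by positivity)
  have hD0 : √(v ^ 2 + 4 * v) ≠ 0 := (Real.sqrt_pos.2 (by positivity)).ne'
  generalize √(v ^ 2 + 4 * v) = D at hD hD0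
  -- Both bases are roots of r² = v r + v, the characteristic equation of the recursion.
  have q1 : ((v + D) / 2) ^ 2 = v * ((v + D) / 2) + v := by linear_combination hD / 4
  have q2 : ((v - D) / 2) ^ 2 = v * ((v - D) / 2) + v := by linear_combination hD / 4
  induction n using Nat.twoStepInduction with
  | zero => rw [h0]; field_simp; ring
  | one => rw [h1]; field_simp; ring
  | more n ih1 ih2 =>
    rw [h, ih1, ih2, pow_add _ n 2, pow_add _ n 2, q1, q2]
    ring

end SymplecticUnipotent

theorem corollary4p6 :
    ∃ P : ℕ → Polynomial ℕ, ∀ (F : Type*) [Field F] [Fintype F], ringChar F ≠ 2 →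
      ∀ v : ℕ, Fintype.card F = v + 1 →
        (∀ n : ℕ, SymplecticUnipotent.numMaxDimOrbits (n + 2) F =
          v * SymplecticUnipotent.numMaxDimOrbits (n + 1) F +
            v * SymplecticUnipotent.numMaxDimOrbits n F) ∧
        (∀ n : ℕ, (SymplecticUnipotent.numMaxDimOrbits n F : ℝ) =
          ((v + 2 + √((v : ℝ) ^ 2 + 4 * v)) / (2 * √((v : ℝ) ^ 2 + 4 * v))) *
              ((v + √((v : ℝ) ^ 2 + 4 * v)) / 2) ^ n +
            ((-v - 2 + √((v : ℝ) ^ 2 + 4 * v)) / (2 * √((v : ℝ) ^ 2 + 4 * v))) *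
              ((v - √((v : ℝ) ^ 2 + 4 * v)) / 2) ^ n) ∧
        ∀ n : ℕ, SymplecticUnipotent.numMaxDimOrbits n F = (P n).eval v := by
  -- The polynomials are fixed before the field, and coefficients in ℕ encode non-negativity.
  refine ⟨SymplecticUnipotent.orbitPoly, fun F _ _ hF v hv => ?_⟩
  have h2 : (2 : F) ≠ 0 := Ring.two_ne_zero hF
  have hcard : Nat.card F = v + 1 := by rw [Nat.card_eq_fintype_card, hv]
  have hv0 : 0 < v := by
    have := Fintype.one_lt_card (α := F)
    omega
  have h0 := SymplecticUnipotent.numMaxDimOrbits_zero h2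
  have h1 := (SymplecticUnipotent.numMaxDimOrbits_one h2).trans hcard
  have h := fun n => SymplecticUnipotent.numMaxDimOrbits_add_two (n := n) h2 hcard
  refine ⟨h, SymplecticUnipotent.binet_of_recursion
    (S := fun n => (SymplecticUnipotent.numMaxDimOrbits n F : ℝ)) (by exact_mod_cast hv0)
    (by exact_mod_cast h0) (by exact_mod_cast h1) (fun n => by exact_mod_cast h n), fun n => ?_⟩
  induction n using Nat.twoStepInduction with
  | zero => simp [h0, SymplecticUnipotent.orbitPoly]
  | one => simp [h1, SymplecticUnipotent.orbitPoly]
  | more n ih1 ih2 => simp [h, ih1, ih2, SymplecticUnipotent.orbitPoly]
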